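/- Let $\mathcal T$ be an ideal triangulation of a connected, compact, oriented 3-manifold $M$: finitely many simplices, each identified with a standard simplex, glued along pairs of faces by affine homeomorphisms, with quotient the space $\widehat M$ obtained from $M$ by collapsing each boundary component to a point; the 0-cells $x_1,\dots,x_v$ of $\widehat M$ are the cusps. Let $n\ge 2$. Identify every simplex with $\{t\in\mathbb R^4_{\ge0}: t_0+t_1+t_2+t_3=n\}$. The integral points of $M$ are the images of the points $(t,k)$, where $t$ is an integral point of simplex $k$ other than a vertex. Let $C_1^n$ be the free abelian group on the integral points, $C_0$ the free abelian group on the cusps, $C_0^n=C_0\otimes\mathbb Z^{n-1}$, and let $\alpha^*\colon C_1^n\to C_0^n$ be the homomorphism sending the integral point $(t,k)$ to $\sum_{i=0}^3 x_{i,k}\otimes e_{t_i}$, where $x_{i,k}$ is the cusp at vertex $i$ of simplex $k$ and $e_0=0$. A homomorphism $f$ from a free abelian group is basic if there is a set $J$ of standard generators, called basic generators, such that $f$ maps $\mathrm{Span}(J)$ isomorphically onto the image of $f$. (1) The map $\alpha^*$ is basic. (2) In each of the following cases sets of integral points as described exist; for every such set the corresponding columns of $\alpha^*$ form a square matrix of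 determinant $\pm n$, and the set is a set of basic generators. (Points of a face with vertices $a,b,c$ are written $(t_a,t_b,t_c)$; maximal trees are taken in the 1-skeleton of $\widehat M$; a self edge is a 1-cell joining a cusp to itself.) (a) One cusp: the points $(1,j,n-1-j)$ with $1\le j\le\frac{n-1}2$ and $(0,j,n-j)$ with $1\le j\le\frac n2$ on any face. (b) More than one cusp, with a self edge (tree with 1-cycle): for a face for which $a$ and $b$ are at the same cusp and $c$ is at another cusp, and a maximal tree $G$ containing the edge $bc$: the points $(1,j,n-1-j)$, $1\le j\le n-1$, of the face together with all integral points on the edges of $G$. (c) More than one cusp, no self edge (tree with 3-cycle): for a face whose vertices are at three distinct cusps and a maximal tree $G$ containing the edges $ab$ and $bc$: the points $(j,n-1-j,1)$, $1\le j\le n-1$, of the face together with all integral points on the edges of $G$. (3) Let $P_n(\mathcal T)$ be the Ptolemy variety: the set of assignments of $c_{t,k}\in\mathbb C\setminus\{0\}$ to all pairs $(t,k)$ as above, satisfying the Ptolemy relations $$c_{a+1001,k}c_{a+0110,k}+c_{a+1100,k}c_{a+0011,k}=c_{a+1010,k}c_{a+0101,k}\qquad (a\in\mathbb Z_{\ge0}^4,\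 a_0+a_1+a_2+a_3=n-2)$$ and, whenever a face pairing carries $(t,k)$ to $(t',k')$ and vertex $i$ to vertex $\sigma(i)$, the identification relation $c_{t,k}=\epsilon\, c_{t',k'}$, where $\epsilon=\prod_{i<j,\ \sigma(i)>\sigma(j)}(-1)^{t_it_j}$. Let the torus $T=(\mathbb C^*)^{v(n-1)}$, with coordinates indexed by the natural generators of $C_0^n$, act on it by the diagonal action, i.e. by scaling $c_{t,k}$ by the monomial whose exponent vector is $\alpha^*(t,k)$. Let $P_n(\mathcal T)_{\mathrm{red}}=P_n(\mathcal T)/T$, let $\mathcal O$ be the coordinate ring of $P_n(\mathcal T)$, i.e. the polynomial ring in the $c_{t,k}^{\pm1}$ modulo the Ptolemy and identification relations, and let $\mathcal O^T$ be its ring of invariants. Then for every set $S$ of integral points that are basic generators for $\alpha^*$, and every choice of a representative $(t,k)$ of each integral point (so that $c_p$ is defined for every integral point $p$), the reduced Ptolemy variety is the subvariety $\{c_p=1,\ p\in S\}$ of $P_n(\mathcal T)$: the natural map $\{c\in P_n(\mathcal T): c_p=1,\ p\in S\}\to P_n(\mathcal T)/T$ is a bijection; restriction maps the $T$-invariant regular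 functions on $P_n(\mathcal T)$ bijectively onto the regular functions on this subvariety; and the natural map $\mathcal O^T\to\mathcal O/(c_p-1:\ p\in S)$ is an isomorphism. -/

import Mathlib

open scoped TensorProduct

/-- A (concrete) ideal triangulation of a compact oriented 3-manifold `M`: the simplices are
indexed by `K`, each is identified with a standard simplex with vertices `Fin 4`, and the face of
simplex `k` opposite vertex `i` is glued to the face of `nbr k i` opposite vertex `perm k i i`.
The affine gluing map sends vertex `j ≠ i` to vertex `perm k i j`.  The value of `perm k i` at `i`
is the vertex opposite the target face.  `orient k` is the sign of the identification of simplex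
`k` with the standard simplex (constantly `1` for an oriented triangulation); the gluing maps are
orientation reversing on faces. -/
structure IdealTriangulation (K : Type*) where
  nbr : K → Fin 4 → K
  perm : K → Fin 4 → Equiv.Perm (Fin 4)
  nbr_nbr : ∀ k i, nbr (nbr k i) (perm k i i) = k
  perm_perm : ∀ k i, perm (nbr k i) (perm k i i) = (perm k i)⁻¹
  ne_self : ∀ k i, (nbr k i, perm k i i) ≠ (k, i)
  orient : K → ℤˣ
  sign_perm : ∀ k i, Equiv.Perm.sign (perm k i) = -(orient k * orient (nbr k i))

/-- The nonvertex integral points `t` of the simplex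
`{(t₀, t₁, t₂, t₃) | 0 ≤ tᵢ ≤ n, t₀ + t₁ + t₂ + t₃ = n}`. -/
abbrev SimplexPoint (n : ℕ) : Type :=
  {t : Fin 4 → ℕ // ∑ i, t i = n ∧ ∀ i, t i ≠ n}

/-- The point with coordinates permuted: vertex `i` is moved to vertex `σ i`. -/
def SimplexPoint.permute {n : ℕ} (σ : Equiv.Perm (Fin 4)) (t : SimplexPoint n) : SimplexPoint n :=
  ⟨fun j => t.1 (σ.symm j), by
    exact ⟨(Equiv.sum_comp σ.symm t.1).trans t.2.1, fun i => t.2.2 _⟩⟩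

/-- The point `a + (unit vector i) + (unit vector j)`, where `a` has coordinate sum `n - 2`. -/
def SimplexPoint.addEdge {n : ℕ} (a : Fin 4 → ℕ) (ha : ∑ i, a i + 2 = n) (i j : Fin 4)
    (hij : i ≠ j) : SimplexPoint n :=
  ⟨fun l => a l + (if l = i then 1 else 0) + (if l = j then 1 else 0), by
    constructor
    · simp [Finset.sum_add_distrib, ← ha, add_assoc]
    · intro l
      have h1 : a l ≤ ∑ i, a i := Finset.single_le_sum (fun _ _ => Nat.zero_le _)
        (Finset.mem_univ l)
      by_cases hi : l = i <;> by_cases hj : l = j <;> simp [hi, hj] <;> grind⟩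

/-- The vector `e_m` in `ℤ^{n-1}` for `1 ≤ m ≤ n - 1`, with the convention `e_0 = 0`. -/
def unitVec (n m : ℕ) : Fin (n - 1) → ℤ := fun j => if (j : ℕ) + 1 = m then 1 else 0

/-- A set `J` of standard generators is a set of basic generators of `f` if `f` maps the span of
`J` isomorphically onto the image of `f`. -/
def IsBasicGenerators {ι N : Type*} [AddCommGroup N] (f : (ι →₀ ℤ) →ₗ[ℤ] N) (J : Set ι) : Prop :=
  Set.InjOn f (Submodule.span ℤ ((fun j => Finsupp.single j (1 : ℤ)) '' J)) ∧
    (Submodule.span ℤ ((fun j => Finsupp.single j (1 : ℤ)) '' J)).map f = LinearMap.range f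

/-- A homomorphism out of `ℤ^ι` is basic if it has a set of basic generators. -/
def IsBasic {ι N : Type*} [AddCommGroup N] (f : (ι →₀ ℤ) →ₗ[ℤ] N) : Prop :=
  ∃ J : Set ι, IsBasicGenerators f J

/-- The sign by which the determinant of a matrix with four blocks of `t 0, …, t 3` columns
changes when block `i` is moved to position `σ i`. -/
def blockSign (σ : Equiv.Perm (Fin 4)) (t : Fin 4 → ℕ) : ℂ :=
  ∏ i, ∏ j, if i < j ∧ σ j < σ i then (-1) ^ (t i * t j) else 1

namespace IdealTriangulation

variable {K : Type*} (T : IdealTriangulation K) (n : ℕ)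

/-- The glued space is connected and nonempty. -/
def IsConnected : Prop :=
  Nonempty K ∧ ∀ k l, Relation.ReflTransGen (fun a b => ∃ i, b = T.nbr a i) k l

/-- The cusps, i.e. the 0-cells: vertices of simplices up to face pairings. -/
def Cusp : Type _ :=
  Quot (fun a b : K × Fin 4 => ∃ i, i ≠ a.2 ∧ b = (T.nbr a.1 i, T.perm a.1 i a.2))

/-- The cusp determined by vertex `i` of simplex `k`. -/
def cusp (k : K) (i : Fin 4) : T.Cusp := Quot.mk _ (k, i)

/-- The unoriented 1-cells: edges of simplices up to reversal and face pairings. -/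
def OneCell : Type _ :=
  Quot (fun a b : K × {e : Fin 4 × Fin 4 // e.1 ≠ e.2} =>
    (a.1 = b.1 ∧ b.2.1 = a.2.1.swap) ∨
    ∃ i, i ≠ a.2.1.1 ∧ i ≠ a.2.1.2 ∧ b.1 = T.nbr a.1 i ∧
      b.2.1 = (T.perm a.1 i a.2.1.1, T.perm a.1 i a.2.1.2))

/-- The 1-cell that is the image of the edge of simplex `k` joining vertices `i` and `j`. -/
def oneCell (k : K) (i j : Fin 4) (h : i ≠ j) : T.OneCell := Quot.mk _ (k, ⟨(i, j), h⟩)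

/-- The unordered pair of cusps joined by a 1-cell. -/
def ends : T.OneCell → Sym2 T.Cusp :=
  Quot.lift (fun a => s(T.cusp a.1 a.2.1.1, T.cusp a.1 a.2.1.2)) (by
    rintro ⟨k, ⟨⟨i, j⟩, h⟩⟩ ⟨k', ⟨⟨i', j'⟩, h'⟩⟩ hab
    rcases hab with ⟨h1, h2⟩ | ⟨l, h1, h2, h3, h4⟩
    · simp only [Prod.swap_prod_mk, Prod.mk.injEq] at h1 h2
      obtain ⟨rfl, rfl⟩ := h2
      subst h1
      exact Sym2.eq_swap
    · simp only [Prod.mk.injEq] at h1 h2 h3 h4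
      obtain ⟨rfl, rfl⟩ := h4
      subst h3
      have e1 : T.cusp k i = T.cusp (T.nbr k l) (T.perm k l i) := Quot.sound ⟨l, h1, rfl⟩
      have e2 : T.cusp k j = T.cusp (T.nbr k l) (T.perm k l j) := Quot.sound ⟨l, h2, rfl⟩
      simp only [e1, e2])

/-- The graph formed by all cusps and the 1-cells in `G` is connected. -/
def Spans (G : Set T.OneCell) : Prop :=
  ∀ x y : T.Cusp, Relation.ReflTransGen (fun a b => ∃ e ∈ G, T.ends e = s(a, b)) x y

/-- Maximal (i.e. spanning) trees in the 1-skeleton: minimal connected spanning subgraphs. -/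
def IsMaximalTree (G : Set T.OneCell) : Prop := Minimal T.Spans G

/-- Pairs `(k, t)` of a simplex and a nonvertex integral point of it. -/
abbrev LabelledPoint (_T : IdealTriangulation K) (n : ℕ) : Type _ := K × SimplexPoint n

/-- The image of `(k, t)` under the pairing of the face opposite vertex `i` of simplex `k`
(meaningful when `t` lies on this face, i.e. `t i = 0`). -/
def glue {n : ℕ} (p : T.LabelledPoint n) (i : Fin 4) : T.LabelledPoint n :=
  (T.nbr p.1 i, p.2.permute (T.perm p.1 i))

/-- The integral points of `M`. -/
def IntegralPoint : Type _ :=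
  Quot (fun p q : T.LabelledPoint n => ∃ i, p.2.1 i = 0 ∧ q = T.glue p i)

/-- The integral point of `M` that is the image of `(k, t)`. -/
def toIntegralPoint {n : ℕ} (p : T.LabelledPoint n) : T.IntegralPoint n := Quot.mk _ p

/-- `C₁ⁿ`, the free abelian group on the integral points of `M`. -/
abbrev C1 : Type _ := T.IntegralPoint n →₀ ℤ

/-- `C₀ⁿ = C₀ ⊗ ℤ^{n-1}`, where `C₀` is the free abelian group on the cusps. -/
abbrev C0 : Type _ := (T.Cusp →₀ ℤ) ⊗[ℤ] (Fin (n - 1) → ℤ)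

/-- The element `∑ᵢ xᵢ ⊗ e_{tᵢ}`, where `xᵢ` is the cusp at vertex `i` of simplex `k`. -/
noncomputable def labelledWeight {n : ℕ} (p : T.LabelledPoint n) : T.C0 n :=
  ∑ i, Finsupp.single (T.cusp p.1 i) 1 ⊗ₜ[ℤ] unitVec n (p.2.1 i)

theorem unitVec_zero (n : ℕ) : unitVec n 0 = 0 := by
  funext j
  simp [unitVec]

theorem cusp_glue (k : K) {i j : Fin 4} (h : i ≠ j) :
    T.cusp (T.nbr k i) (T.perm k i j) = T.cusp k j :=
  (Quot.sound ⟨i, h, rfl⟩ : T.cusp k j = _).symm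

theorem labelledWeight_glue {n : ℕ} (p : T.LabelledPoint n) (i : Fin 4) (h : p.2.1 i = 0) :
    T.labelledWeight (T.glue p i) = T.labelledWeight p := by
  unfold labelledWeight glue SimplexPoint.permute
  rw [← Equiv.sum_comp (T.perm p.1 i)]
  refine Finset.sum_congr rfl fun j _ => ?_
  simp only [Equiv.symm_apply_apply]
  by_cases hj : i = j
  · subst hj
    simp [h, unitVec_zero]
  · rw [cusp_glue T _ hj]

/-- The value of `α*` on an integral point. -/
noncomputable def weight {n : ℕ} : T.IntegralPoint n → T.C0 n :=
  Quot.lift T.labelledWeight (by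
    rintro p q ⟨i, h, rfl⟩
    exact (T.labelledWeight_glue p i h).symm)

/-- The map `α* : C₁ⁿ → C₀ⁿ = C₀ ⊗ ℤ^{n-1}`. -/
noncomputable def alphaStar : T.C1 n →ₗ[ℤ] T.C0 n :=
  Finsupp.linearCombination ℤ T.weight

/-- The natural basis `x ⊗ e_j` of `C₀ⁿ`. -/
noncomputable def basisC0 : Module.Basis (T.Cusp × Fin (n - 1)) ℤ (T.C0 n) :=
  Module.Basis.tensorProduct Finsupp.basisSingleOne (Pi.basisFun ℤ (Fin (n - 1)))

noncomputable instance [Finite K] : Fintype T.Cusp :=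
  @Fintype.ofFinite T.Cusp (Quot.finite _)

open Classical in
/-- The columns of `α*` corresponding to the integral points in `S` form a square matrix of
determinant `± d` (the rows are indexed by the natural generators `x ⊗ e_j`, and the set `S` is
enumerated by the same index set). -/
def ColumnsHaveDet {n : ℕ} [Finite K] (S : Set (T.IntegralPoint n)) (d : ℕ) : Prop :=
  ∃ e : T.Cusp × Fin (n - 1) ≃ S,
    |(Matrix.of fun r c =>
      (T.basisC0 n).repr (T.alphaStar n (Finsupp.single (e c : T.IntegralPoint n) 1)) r).det| = d

/-! ### The explicit sets of integral points -/

/-- The integral points on the 1-cells in `G`. -/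
def edgePoints (G : Set T.OneCell) : Set (T.IntegralPoint n) :=
  {P | ∃ (p : T.LabelledPoint n) (i j : Fin 4) (h : i ≠ j), T.toIntegralPoint p = P ∧
    p.2.1 i + p.2.1 j = n ∧ T.oneCell p.1 i j h ∈ G}

/-- The integral points on the face of simplex `k` with (distinct) vertices `a`, `b`, `c` whose
coordinates at `a`, `b`, `c` satisfy `Q`. -/
def facePoints (k : K) (a b c : Fin 4) (Q : ℕ → ℕ → ℕ → Prop) : Set (T.IntegralPoint n) :=
  {P | ∃ t : SimplexPoint n, T.toIntegralPoint (k, t) = P ∧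
    t.1 a + t.1 b + t.1 c = n ∧ Q (t.1 a) (t.1 b) (t.1 c)}

/-- One cusp: the points `(1, j, n-1-j)` with `1 ≤ j ≤ (n-1)/2` and `(0, j, n-j)` with
`1 ≤ j ≤ n/2` on a face. -/
def IsOneCuspFamily (S : Set (T.IntegralPoint n)) : Prop :=
  ∃ (k : K) (a b c : Fin 4), a ≠ b ∧ b ≠ c ∧ a ≠ c ∧
    S = T.facePoints n k a b c (fun x y z => x ≤ 1 ∧ 1 ≤ y ∧ y ≤ z)

/-- Tree with 1-cycle: for a face whose vertices `a`, `b` lie at a cusp `x₁` and whose vertex `c`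
lies at a cusp `x₂ ≠ x₁`, and a maximal tree `G` containing the edge `bc` of the face, the points
`(1, j, n-1-j)`, `1 ≤ j ≤ n-1`, of the face together with the edge points on `G`. -/
def IsOneCycleFamily (S : Set (T.IntegralPoint n)) : Prop :=
  ∃ (k : K) (a b c : Fin 4) (G : Set T.OneCell) (_ : a ≠ b) (hbc : b ≠ c) (_ : a ≠ c),
    T.cusp k a = T.cusp k b ∧ T.cusp k b ≠ T.cusp k c ∧
    T.IsMaximalTree G ∧ T.oneCell k b c hbc ∈ G ∧
    S = T.facePoints n k a b c (fun x y _ => x = 1 ∧ 1 ≤ y) ∪ T.edgePoints n G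

/-- Tree with 3-cycle: for a face whose vertices `a`, `b`, `c` lie at three distinct cusps, and a
maximal tree `G` containing the edges `ab` and `bc` of the face, the points `(j, n-1-j, 1)`,
`1 ≤ j ≤ n-1`, of the face together with the edge points on `G`. -/
def IsThreeCycleFamily (S : Set (T.IntegralPoint n)) : Prop :=
  ∃ (k : K) (a b c : Fin 4) (G : Set T.OneCell) (hab : a ≠ b) (hbc : b ≠ c) (_ : a ≠ c),
    T.cusp k a ≠ T.cusp k b ∧ T.cusp k b ≠ T.cusp k c ∧ T.cusp k a ≠ T.cusp k c ∧
    T.IsMaximalTree G ∧ T.oneCell k a b hab ∈ G ∧ T.oneCell k b c hbc ∈ G ∧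
    S = T.facePoints n k a b c (fun x _ z => 1 ≤ x ∧ z = 1) ∪ T.edgePoints n G

/-- Some 1-cell joins a cusp to itself. -/
def HasSelfEdge : Prop := ∃ e : T.OneCell, (T.ends e).IsDiag

/-! ### The Ptolemy variety and the diagonal action -/

/-- The difference of the two sides of the Ptolemy relation of simplex `k` at `a`, evaluated at
coordinates `c` in a commutative ring. -/
def ptolemyExpr {n : ℕ} {R : Type*} [CommRing R] (c : T.LabelledPoint n → R) (k : K)
    (a : Fin 4 → ℕ) (ha : ∑ i, a i + 2 = n) : R :=
  c (k, .addEdge a ha 0 3 (by decide)) * c (k, .addEdge a ha 1 2 (by decide)) +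
    c (k, .addEdge a ha 0 1 (by decide)) * c (k, .addEdge a ha 2 3 (by decide)) -
    c (k, .addEdge a ha 0 2 (by decide)) * c (k, .addEdge a ha 1 3 (by decide))

/-- The Ptolemy variety `P_n`, as the set of its points: Ptolemy assignments. -/
def ptolemyVariety : Set (T.LabelledPoint n → ℂ) :=
  {c | (∀ p, c p ≠ 0) ∧
    (∀ k a (ha : ∑ i, a i + 2 = n), T.ptolemyExpr c k a ha = 0) ∧
    ∀ p i, p.2.1 i = 0 → c p = blockSign (T.perm p.1 i) p.2.1 * c (T.glue p i)}

/-- The torus `D^v = (ℂˣ)^{v(n-1)}`; `(a₁, …, a_{n-1})` corresponds to the diagonal matrix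
`diag(a₁, a₂/a₁, …, a_{n-1}/a_{n-2}, 1/a_{n-1})`. -/
abbrev Torus : Type _ := T.Cusp → Fin (n - 1) → ℂˣ

/-- The character of the torus by which it scales the Ptolemy coordinate at `(k, t)`: the
coordinates of the torus raised to the coefficients of `∑ᵢ xᵢ ⊗ e_{tᵢ}`. -/
def character {n : ℕ} (x : T.Torus n) (p : T.LabelledPoint n) : ℂˣ :=
  ∏ i, ∏ j, x (T.cusp p.1 i) j ^ unitVec n (p.2.1 i) j

theorem character_one {n : ℕ} (p : T.LabelledPoint n) : T.character 1 p = 1 := by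
  simp [character]

theorem character_mul {n : ℕ} (x y : T.Torus n) (p : T.LabelledPoint n) :
    T.character (x * y) p = T.character x p * T.character y p := by
  simp [character, mul_zpow, Finset.prod_mul_distrib]

theorem character_glue {n : ℕ} (x : T.Torus n) (p : T.LabelledPoint n) (i : Fin 4)
    (h : p.2.1 i = 0) : T.character x (T.glue p i) = T.character x p := by
  unfold character glue SimplexPoint.permute
  rw [← Equiv.prod_comp (T.perm p.1 i)]
  refine Finset.prod_congr rfl fun j _ => ?_
  simp only [Equiv.symm_apply_apply]
  by_cases hj : i = j
  · subst hj
    simp [h, unitVec_zero]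
  · rw [cusp_glue T _ hj]

/-- The common weight of the three terms of a Ptolemy relation. -/
def ptolemyCharacter {n : ℕ} (x : T.Torus n) (k : K) (a : Fin 4 → ℕ) : ℂˣ :=
  ∏ i, ((∏ j, x (T.cusp k i) j ^ unitVec n (a i) j) *
    ∏ j, x (T.cusp k i) j ^ unitVec n (a i + 1) j)

theorem character_addEdge {n : ℕ} (x : T.Torus n) (k : K) (a : Fin 4 → ℕ)
    (ha : ∑ i, a i + 2 = n) (i j l m : Fin 4) (hij : i ≠ j) (hlm : l ≠ m)
    (h : i ≠ l ∧ i ≠ m ∧ j ≠ l ∧ j ≠ m) :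
    T.character x (k, .addEdge a ha i j hij) * T.character x (k, .addEdge a ha l m hlm) =
      T.ptolemyCharacter x k a := by
  unfold character ptolemyCharacter SimplexPoint.addEdge
  rw [← Finset.prod_mul_distrib]
  refine Finset.prod_congr rfl fun r _ => ?_
  have hr : r = i ∨ r = j ∨ r = l ∨ r = m := by
    revert i j l m r
    decide
  obtain ⟨h1, h2, h3, h4⟩ := h
  rcases hr with rfl | rfl | rfl | rfl
  · simp [hij, h1, h2, mul_comm]
  · simp [hij.symm, h3, h4, mul_comm]
  · simp [h1.symm, h3.symm, hlm]
  · simp [h2.symm, h4.symm, hlm.symm]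

/-- Rescaling all coordinates by a torus element rescales each Ptolemy relation. -/
theorem ptolemyExpr_character {n : ℕ} {R : Type*} [CommRing R] [Algebra ℂ R] (x : T.Torus n)
    (c : T.LabelledPoint n → R) (k : K) (a : Fin 4 → ℕ) (ha : ∑ i, a i + 2 = n) :
    T.ptolemyExpr (fun p => algebraMap ℂ R (T.character x p) * c p) k a ha =
      algebraMap ℂ R (T.ptolemyCharacter x k a) * T.ptolemyExpr c k a ha := by
  have h1 := T.character_addEdge x k a ha 0 3 1 2 (by decide) (by decide) (by decide)
  have h2 := T.character_addEdge x k a ha 0 1 2 3 (by decide) (by decide) (by decide)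
  have h3 := T.character_addEdge x k a ha 0 2 1 3 (by decide) (by decide) (by decide)
  replace h1 := congrArg (fun u : ℂˣ => algebraMap ℂ R u) h1
  replace h2 := congrArg (fun u : ℂˣ => algebraMap ℂ R u) h2
  replace h3 := congrArg (fun u : ℂˣ => algebraMap ℂ R u) h3
  simp only [Units.val_mul, map_mul] at h1 h2 h3
  unfold ptolemyExpr
  linear_combination
    (c (k, .addEdge a ha 0 3 (by decide)) * c (k, .addEdge a ha 1 2 (by decide))) * h1 +
    (c (k, .addEdge a ha 0 1 (by decide)) * c (k, .addEdge a ha 2 3 (by decide))) * h2 -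
    (c (k, .addEdge a ha 0 2 (by decide)) * c (k, .addEdge a ha 1 3 (by decide))) * h3

/-- The diagonal action on the Ptolemy variety. -/
noncomputable instance : MulAction (T.Torus n) (T.ptolemyVariety n) where
  smul x c := ⟨fun p => (T.character x p : ℂ) * c.1 p, by
    obtain ⟨h1, h2, h3⟩ := c.2
    refine ⟨fun p => mul_ne_zero (Units.ne_zero _) (h1 p), fun k a ha => ?_, fun p i hp => ?_⟩
    · have := T.ptolemyExpr_character x c.1 k a ha
      simp only [Algebra.algebraMap_self, RingHom.id_apply] at this
      rw [this, h2, mul_zero]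
    · change (T.character x p : ℂ) * c.1 p =
        blockSign (T.perm p.1 i) p.2.1 * ((T.character x (T.glue p i) : ℂ) * c.1 (T.glue p i))
      rw [T.character_glue x p i hp, h3 p i hp]
      ring⟩
  one_smul c := Subtype.ext (funext fun p => by
    change ((T.character 1 p : ℂˣ) : ℂ) * c.1 p = c.1 p
    simp [character_one])
  mul_smul x y c := Subtype.ext (funext fun p => by
    change ((T.character (x * y) p : ℂˣ) : ℂ) * c.1 p =
      (T.character x p : ℂ) * ((T.character y p : ℂ) * c.1 p)
    rw [character_mul, Units.val_mul, mul_assoc])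

/-- The points of the reduced Ptolemy variety `P_n / T`. -/
abbrev ReducedPtolemyVariety : Type _ :=
  MulAction.orbitRel.Quotient (T.Torus n) (T.ptolemyVariety n)

/-- The Ptolemy assignments with coordinate `1` at the points of `S`, where `rep` selects a
representative `(k, t)` of each integral point. -/
def slice {n : ℕ} (rep : T.IntegralPoint n → T.LabelledPoint n) (S : Set (T.IntegralPoint n)) :
    Set (T.LabelledPoint n → ℂ) :=
  {c | c ∈ T.ptolemyVariety n ∧ ∀ P ∈ S, c (rep P) = 1}

/-- The ring of regular functions on a closed subset `V` of `P_n`: the functions generated by the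
Ptolemy coordinates and their inverses. -/
def regularFunctions {n : ℕ} (V : Set (T.LabelledPoint n → ℂ)) : Subalgebra ℂ (V → ℂ) :=
  Algebra.adjoin ℂ ((Set.range fun p (c : V) => c.1 p) ∪ Set.range fun p (c : V) => (c.1 p)⁻¹)

/-- The regular functions on `P_n` that are invariant under the diagonal action. -/
def invariantFunctions : Set (T.ptolemyVariety n → ℂ) :=
  {f | f ∈ T.regularFunctions (T.ptolemyVariety n) ∧
    ∀ (x : T.Torus n) (c : T.ptolemyVariety n), f (x • c) = f c}

/-! ### The coordinate ring by generators and relations -/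

/-- Polynomials in the Ptolemy coordinates (`inl`) and dummy variables (`inr`), which will be the
inverses of the Ptolemy coordinates. -/
abbrev PolyRing : Type _ := MvPolynomial (T.LabelledPoint n ⊕ T.LabelledPoint n) ℂ

/-- The Ptolemy relations, the identification relations, and the invertibility of the Ptolemy
coordinates. -/
def relations : Set (T.PolyRing n) :=
  {f | (∃ k a, ∃ ha : ∑ i, a i + 2 = n,
        f = T.ptolemyExpr (fun p => MvPolynomial.X (Sum.inl p)) k a ha) ∨
     (∃ p i, p.2.1 i = 0 ∧
        f = MvPolynomial.X (Sum.inl p) -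
          MvPolynomial.C (blockSign (T.perm p.1 i) p.2.1) *
            MvPolynomial.X (Sum.inl (T.glue p i))) ∨
     (∃ p, f = MvPolynomial.X (Sum.inl p) * MvPolynomial.X (Sum.inr p) - 1)}

/-- The ideal generated by the relations. -/
noncomputable def relationIdeal : Ideal (T.PolyRing n) := Ideal.span (T.relations n)

/-- The coordinate ring `𝒪` of the Ptolemy variety. -/
abbrev CoordRing : Type _ := T.PolyRing n ⧸ T.relationIdeal n

/-- The diagonal action on polynomials. -/
noncomputable def polyAct {n : ℕ} (x : T.Torus n) : T.PolyRing n →ₐ[ℂ] T.PolyRing n :=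
  MvPolynomial.aeval (Sum.elim
    (fun p => MvPolynomial.C (T.character x p : ℂ) * MvPolynomial.X (Sum.inl p))
    (fun p => MvPolynomial.C ((T.character x p)⁻¹ : ℂˣ).1 * MvPolynomial.X (Sum.inr p)))

theorem relationIdeal_le_comap {n : ℕ} (x : T.Torus n) :
    T.relationIdeal n ≤ (T.relationIdeal n).comap (T.polyAct x) := by
  unfold relationIdeal
  rw [Ideal.span_le]
  rintro f hf
  have hmem := Ideal.subset_span hf
  rcases hf with ⟨k, a, ha, rfl⟩ | ⟨p, i, hp, rfl⟩ | ⟨p, rfl⟩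
  · have h := T.ptolemyExpr_character (R := T.PolyRing n) x
      (fun p => MvPolynomial.X (Sum.inl p)) k a ha
    have : T.polyAct x (T.ptolemyExpr (fun p => MvPolynomial.X (Sum.inl p)) k a ha) =
        T.ptolemyExpr (fun p => algebraMap ℂ (T.PolyRing n) (T.character x p) *
          MvPolynomial.X (Sum.inl p)) k a ha := by
      simp [ptolemyExpr, polyAct, MvPolynomial.algebraMap_eq]
    rw [SetLike.mem_coe, Ideal.mem_comap, this, h]
    exact Ideal.mul_mem_left _ _ hmem
  · rw [SetLike.mem_coe, Ideal.mem_comap]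
    convert Ideal.mul_mem_left _ (MvPolynomial.C (T.character x p : ℂ)) hmem using 1
    simp only [polyAct, map_sub, map_mul, MvPolynomial.aeval_X, Sum.elim_inl,
      MvPolynomial.algHom_C, MvPolynomial.algebraMap_eq, T.character_glue x p i hp]
    ring
  · rw [SetLike.mem_coe, Ideal.mem_comap]
    have hc : (MvPolynomial.C (T.character x p : ℂ) : T.PolyRing n) *
        MvPolynomial.C ((T.character x p)⁻¹ : ℂˣ).1 = 1 := by
      rw [← MvPolynomial.C_mul, Units.mul_inv, MvPolynomial.C_1]
    have key : T.polyAct x (MvPolynomial.X (Sum.inl p) * MvPolynomial.X (Sum.inr p) - 1) =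
        MvPolynomial.X (Sum.inl p) * MvPolynomial.X (Sum.inr p) - 1 := by
      simp only [polyAct, map_sub, map_mul, map_one, MvPolynomial.aeval_X, Sum.elim_inl,
        Sum.elim_inr]
      linear_combination (MvPolynomial.X (Sum.inl p) * MvPolynomial.X (Sum.inr p)) * hc
    rw [key]
    exact hmem

/-- The diagonal action on the coordinate ring. -/
noncomputable def coordAct {n : ℕ} (x : T.Torus n) : T.CoordRing n →ₐ[ℂ] T.CoordRing n :=
  Ideal.quotientMapₐ (T.relationIdeal n) (T.polyAct x) (T.relationIdeal_le_comap x)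

/-- The ring of invariants `𝒪^T`. -/
noncomputable def invariantRing : Subalgebra ℂ (T.CoordRing n) :=
  ⨅ x : T.Torus n, AlgHom.equalizer (T.coordAct x) (AlgHom.id ℂ (T.CoordRing n))

/-- The ideal of `𝒪` generated by the elements `c_P - 1`, `P ∈ S`. -/
noncomputable def sliceIdeal {n : ℕ} (rep : T.IntegralPoint n → T.LabelledPoint n)
    (S : Set (T.IntegralPoint n)) : Ideal (T.CoordRing n) :=
  Ideal.span ((fun P => Ideal.Quotient.mk (T.relationIdeal n)
    (MvPolynomial.X (Sum.inl (rep P))) - 1) '' S)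

end IdealTriangulation

/-!
A set `S` of integral points consists of basic generators if and only if the weights of its points
are a basis of the lattice spanned by all weights. This lattice lies in the kernel of the degree map
`C₀ⁿ → ℤ/n`, `x ⊗ e_m ↦ m`, which has index `n`. Modulo the weights of one of the explicit sets, an
edge gives `x ⊗ e_m = -y ⊗ e_(n-m)`, and comparing this with the relations on the face shows that
`x ⊗ e_m` is `m` times `x ⊗ e_1` at one cusp `x`; walking along the tree carries this to all cusps.
So the weights of `S` span the whole kernel, and since there are no more of them than the rank of
`C₀ⁿ`, they are independent, with determinant `± n`.

The weight lattice grades the coordinate ring. Given basic generators `S`, acting by the torus point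
whose coordinates in the basis `S` of the weight lattice are the functions `c_p⁻¹` normalizes all
`c_p`, `p ∈ S`, to `1`. On functions this is a retraction onto the invariants that is the identity
modulo the ideal of the slice; it kills this ideal, and it fixes invariants because these have
degree `0`, by independence of characters. On points it is realized by the torus itself, because
`ℂˣ` is divisible and characters of the weight lattice therefore extend to `C₀ⁿ`.
-/

section BasicGenerators

variable {ι N : Type*} [AddCommGroup N] {w : ι → N} {J : Set ι}

theorem isBasicGenerators_linearCombination_iff :
    IsBasicGenerators (Finsupp.linearCombination ℤ w) J ↔
      LinearIndepOn ℤ w J ∧ Submodule.span ℤ (w '' J) = Submodule.span ℤ (Set.range w) := by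
  rw [IsBasicGenerators, ← Finsupp.supported_eq_span_single, ← LinearMap.disjoint_ker_iff_injOn,
    ← linearIndepOn_iff_disjoint, Finsupp.range_linearCombination,
    Finsupp.span_image_eq_map_linearCombination]

/-- The basis of the lattice spanned by a family `w` that consists of the values of `w` at a set of
basic generators. -/
noncomputable def IsBasicGenerators.basis
    (h : IsBasicGenerators (Finsupp.linearCombination ℤ w) J) :
    Module.Basis J ℤ (Submodule.span ℤ (Set.range w)) :=
  have h := isBasicGenerators_linearCombination_iff.1 h
  (Module.Basis.span h.1).map
    (LinearEquiv.ofEq _ _ ((congrArg _ (Set.image_eq_range w J).symm).trans h.2))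

theorem IsBasicGenerators.coe_basis (h : IsBasicGenerators (Finsupp.linearCombination ℤ w) J)
    (j : J) : (h.basis j : N) = w j := by
  have h' := isBasicGenerators_linearCombination_iff.1 h
  exact Module.Basis.coe_span_apply h'.1 j

end BasicGenerators

section Index

variable {M κ : Type*} [AddCommGroup M] {w : κ → M}

theorem card_eq_finrank_and_linearIndependent_of_finite_quotient_span [Module.Finite ℤ M]
    [Module.IsTorsionFree ℤ M] [Finite κ] [Finite (M ⧸ Submodule.span ℤ (Set.range w))]
    (hκ : Nat.card κ ≤ Module.finrank ℤ M) :
    Nat.card κ = Module.finrank ℤ M ∧ LinearIndependent ℤ w := by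
  have := Fintype.ofFinite κ
  have : (Submodule.span ℤ (Set.range w)).toAddSubgroup.FiniteIndex :=
    @AddSubgroup.finiteIndex_of_finite_quotient _ _ _
      ‹Finite (M ⧸ Submodule.span ℤ (Set.range w))›
  have hrank : (Set.range w).finrank ℤ = Module.finrank ℤ M :=
    AddSubgroup.finrank_eq_of_finiteIndex (Submodule.span ℤ (Set.range w)).toAddSubgroup
  rw [Nat.card_eq_fintype_card] at hκ ⊢
  have hw : LinearIndependent ℤ w := linearIndependent_iff_card_le_finrank_span.2 (hrank ▸ hκ)
  exact ⟨hrank ▸ linearIndependent_iff_card_eq_finrank_span.1 hw, hw⟩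

theorem abs_det_toMatrix_eq_card_quotient_span [Fintype κ] [DecidableEq κ]
    (b : Module.Basis κ ℤ M) (hw : LinearIndependent ℤ w) :
    |(b.toMatrix w).det| = Nat.card (M ⧸ Submodule.span ℤ (Set.range w)) := by
  have : Module.Finite ℤ M := Module.Finite.of_basis b
  have : Module.Free ℤ M := Module.Free.of_basis b
  rw [← Submodule.natAbs_det_basis_change b _ (Module.Basis.span hw), Int.natCast_natAbs,
    Module.Basis.det_apply]
  congr 3
  exact funext fun i => (Module.Basis.coe_span_apply hw i).symm

end Index

section Characters

theorem baer_additive_units (k : Type*) [Field k] [IsAlgClosed k] :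
    Module.Baer ℤ (Additive kˣ) := by
  have exists_root {d : ℕ} (hd : d ≠ 0) :
      Function.Surjective fun u : Additive kˣ => d • u := by
    intro u
    obtain ⟨z, hz⟩ := IsAlgClosed.exists_pow_nat_eq (u.toMul : k) (Nat.pos_of_ne_zero hd)
    have hz0 : z ≠ 0 := by
      rintro rfl
      exact u.toMul.ne_zero (by rw [← hz, zero_pow hd])
    exact ⟨Additive.ofMul (Units.mk0 z hz0), Units.ext hz⟩
  have := divisibleByOfSMulRightSurj (Additive kˣ) ℕ exists_root
  have := AddGroup.divisibleByIntOfDivisibleByNat (Additive kˣ)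
  exact Module.Baer.of_divisible _

theorem eq_zero_of_forall_linearMap_toMul_eq_one {k L : Type*} [Field k] [CharZero k]
    [AddCommGroup L] [Module.Free ℤ L] {v : L}
    (h : ∀ φ : L →ₗ[ℤ] Additive kˣ, (φ v).toMul = 1) : v = 0 := by
  refine (Module.forall_dual_apply_eq_zero_iff ℤ v).1 fun f => ?_
  have hpow : (Units.mk0 (2 : k) two_ne_zero) ^ f v = 1 :=
    h ((LinearMap.toSpanSingleton ℤ _ (Additive.ofMul (Units.mk0 (2 : k) two_ne_zero))) ∘ₗ f)
  have hpow' : (2 : ℚ) ^ f v = 1 := by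
    apply Rat.cast_injective (α := k)
    simpa using congrArg Units.val hpow
  exact (zpow_eq_one_iff_right₀ (by norm_num) (by norm_num)).1 hpow'

theorem eq_zero_of_forall_character_sum_eq_zero {k L V : Type*} [Field k] [CharZero k]
    [AddCommGroup L] [Module.Free ℤ L] [AddCommGroup V] [Module k V] {g : L →₀ V}
    (h : ∀ φ : L →ₗ[ℤ] Additive kˣ, (g.sum fun v a => ((φ v).toMul : k) • a) = 0) : g = 0 := by
  let evaluation (v : L) : Multiplicative (L →ₗ[ℤ] Additive kˣ) →* k :=
    (Units.coeHom k).comp (AddMonoidHom.toMultiplicativeLeft (LinearMap.evalAddMonoidHom v))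
  have evaluation_injective : Function.Injective evaluation := fun v v' hvv' => by
    rw [← sub_eq_zero]
    refine eq_zero_of_forall_linearMap_toMul_eq_one (k := k) fun φ => ?_
    have hφ : φ v = φ v' := Units.ext (DFunLike.congr_fun hvv' (Multiplicative.ofAdd φ))
    rw [map_sub, hφ, sub_self, toMul_zero]
  have hli := (linearIndependent_monoidHom _ k).comp _ evaluation_injective
  ext v
  refine (Module.forall_dual_apply_eq_zero_iff k _).1 fun ψ => ?_
  have hψ : g.mapRange ψ (map_zero ψ) = 0 := by
    refine (linearIndependent_iff.1 hli) _ (funext fun φ => ?_)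
    have hφ := congrArg ψ (h φ.toAdd)
    rw [map_zero, Finsupp.sum, map_sum] at hφ
    rw [Finsupp.linearCombination_apply, Finsupp.sum_mapRange_index (by simp),
      Finsupp.sum, Finset.sum_apply]
    refine Eq.trans (Finset.sum_congr rfl fun v _ => ?_) hφ
    rw [map_smul, Pi.smul_apply, smul_eq_mul, mul_comm]
    rfl
  simpa using DFunLike.congr_fun hψ v

end Characters

section Slice

open AddMonoidAlgebra

/-- The `ℤ`-linear map that a ring homomorphism induces on groups of units, written additively. -/
def additiveUnitsMap {A B : Type*} [CommRing A] [CommRing B] (f : A →+* B) :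
    Additive Aˣ →ₗ[ℤ] Additive Bˣ :=
  (MonoidHom.toAdditive (Units.map (f : A →* B))).toIntLinearMap

variable {k A L : Type*} [Field k] [CommRing A] [Algebra k A] [AddCommGroup L]

/-- The monomials with exponents in `L`, as units of the ring of Laurent polynomials. -/
noncomputable def monomialUnit (A L : Type*) [CommRing A] [AddCommGroup L] :
    L →ₗ[ℤ] Additive A[L]ˣ :=
  AddMonoidHom.toIntLinearMap (MonoidHom.toAdditiveRight (of A L).toHomUnits)

/-- The homomorphism from Laurent polynomials with exponents in `L` to their ring of coefficients
that substitutes the unit `ψ v` for the monomial with exponent `v`. -/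
noncomputable def specialize (ψ : L →ₗ[ℤ] Additive Aˣ) : A[L] →ₐ[A] A :=
  AddMonoidAlgebra.lift A A L
    ((Units.coeHom A).comp (AddMonoidHom.toMultiplicativeLeft ψ.toAddMonoidHom))

theorem specialize_apply (ψ : L →ₗ[ℤ] Additive Aˣ) (F : A[L]) :
    specialize ψ F = F.coeff.sum fun v a => a * ((ψ v).toMul : A) :=
  AddMonoidAlgebra.lift_apply _ _

theorem specialize_single (ψ : L →ₗ[ℤ] Additive Aˣ) (v : L) (a : A) :
    specialize ψ (single v a) = a * ((ψ v).toMul : A) :=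
  AddMonoidAlgebra.lift_single _ _ _

/-- A coaction `γ` of the torus with character lattice `L` on `A`, specialized at a point of this
torus with coordinates in `A`. Points with coordinates in `k` give the action of the torus, other
points give endomorphisms such as the projection to a slice. -/
noncomputable def twist (γ : A →ₐ[k] A[L]) (ψ : L →ₗ[ℤ] Additive Aˣ) : A →ₐ[k] A :=
  ((specialize ψ).restrictScalars k).comp γ

/-- The elements of `A` fixed by all points with coordinates in `k` of the torus with character
lattice `L`. -/
noncomputable def torusInvariants (γ : A →ₐ[k] A[L]) : Subalgebra k A :=
  ⨅ φ : L →ₗ[ℤ] Additive kˣ,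
    AlgHom.equalizer (twist γ (additiveUnitsMap (algebraMap k A) ∘ₗ φ)) (AlgHom.id k A)

theorem mem_torusInvariants {γ : A →ₐ[k] A[L]} {f : A} :
    f ∈ torusInvariants γ ↔
      ∀ φ : L →ₗ[ℤ] Additive kˣ, twist γ (additiveUnitsMap (algebraMap k A) ∘ₗ φ) f = f := by
  simp [torusInvariants, Algebra.mem_iInf, AlgHom.mem_equalizer]

theorem twist_eq_self_of_mem_torusInvariants [CharZero k] [Module.Free ℤ L] {γ : A →ₐ[k] A[L]}
    {f : A} (hf : f ∈ torusInvariants γ) (ψ : L →ₗ[ℤ] Additive Aˣ) : twist γ ψ f = f := by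
  have hγ : γ f = single 0 f := by
    rw [← sub_eq_zero]
    apply AddMonoidAlgebra.coeff_injective
    refine eq_zero_of_forall_character_sum_eq_zero (k := k) fun φ => ?_
    have hφ : specialize (additiveUnitsMap (algebraMap k A) ∘ₗ φ) (γ f - single 0 f) = 0 := by
      rw [map_sub, specialize_single, map_zero, toMul_zero, Units.val_one, mul_one, sub_eq_zero]
      exact mem_torusInvariants.1 hf φ
    rw [← hφ, specialize_apply]
    exact Finset.sum_congr rfl fun v _ => (Algebra.smul_def _ _).trans (mul_comm _ _)
  rw [twist, AlgHom.comp_apply, hγ]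
  simp [specialize_single]

variable {Λ ι : Type*} {γ : A →ₐ[k] A[L]} {u : Λ → Aˣ} {w : Λ → L}

theorem additiveUnitsMap_twist (hγ : ∀ p, γ (u p) = single (w p) (u p : A))
    (ψ : L →ₗ[ℤ] Additive Aˣ) (p : Λ) :
    additiveUnitsMap (twist γ ψ : A →+* A) (Additive.ofMul (u p)) =
      Additive.ofMul (u p) + ψ (w p) := by
  refine Additive.toMul.injective (Units.ext ?_)
  change specialize ψ (γ (u p)) = u p * ((ψ (w p)).toMul : A)
  rw [hγ, specialize_single]

theorem algHom_ext_of_units {B : Type*} [CommRing B] [Algebra k B]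
    (hu : Algebra.adjoin k
      ((Set.range fun p => (u p : A)) ∪ Set.range fun p => ((u p)⁻¹ : Aˣ).1) = ⊤)
    {F G : A →ₐ[k] B}
    (h : ∀ p, additiveUnitsMap (F : A →+* B) (Additive.ofMul (u p)) =
      additiveUnitsMap (G : A →+* B) (Additive.ofMul (u p))) : F = G := by
  refine AlgHom.ext_of_adjoin_eq_top hu ?_
  rintro _ (⟨p, rfl⟩ | ⟨p, rfl⟩)
  · exact congrArg (fun v => (v.toMul : B)) (h p)
  · exact congrArg (fun v => ((-v).toMul : B)) (h p)

variable (hγ : ∀ p, γ (u p) = single (w p) (u p : A))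
  (hu : Algebra.adjoin k
    ((Set.range fun p => (u p : A)) ∪ Set.range fun p => ((u p)⁻¹ : Aˣ).1) = ⊤)
  (b : Module.Basis ι ℤ L) {r : ι → Λ} (hr : ∀ i, w (r i) = b i)

/-- The point of the torus, with coordinates in `A`, at which the `i`-th element of the basis `b`
of the character lattice takes the value `(u (r i))⁻¹`. Twisting by it makes all `u (r i)` equal
to `1`. -/
noncomputable def normalizer (b : Module.Basis ι ℤ L) (u : Λ → Aˣ) (r : ι → Λ) :
    L →ₗ[ℤ] Additive Aˣ :=
  b.constr ℤ fun i => -Additive.ofMul (u (r i))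

theorem normalizer_basis (i : ι) : normalizer b u r (b i) = -Additive.ofMul (u (r i)) :=
  b.constr_basis ℤ _ i

include hγ hr in
theorem twist_normalizer_unit (i : ι) : twist γ (normalizer b u r) (u (r i)) = 1 := by
  have h := additiveUnitsMap_twist hγ (normalizer b u r) (r i)
  rw [hr, normalizer_basis, add_neg_cancel] at h
  exact congrArg (fun v => (v.toMul : A)) h

include hγ hu hr in
theorem twist_normalizer_mem_torusInvariants (f : A) :
    twist γ (normalizer b u r) f ∈ torusInvariants γ := by
  refine mem_torusInvariants.2 fun φ => ?_
  set φA := additiveUnitsMap (algebraMap k A) ∘ₗ φ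
  have hν : additiveUnitsMap (twist γ φA : A →+* A) ∘ₗ normalizer b u r =
      normalizer b u r - φA := by
    refine b.ext fun i => ?_
    rw [LinearMap.comp_apply, LinearMap.sub_apply, normalizer_basis, map_neg,
      additiveUnitsMap_twist hγ, hr, neg_add, sub_eq_add_neg]
  have hcomp : (twist γ φA).comp (twist γ (normalizer b u r)) = twist γ (normalizer b u r) := by
    refine algHom_ext_of_units hu fun p => ?_
    change additiveUnitsMap (twist γ φA : A →+* A)
      (additiveUnitsMap (twist γ (normalizer b u r) : A →+* A) (Additive.ofMul (u p))) = _
    rw [additiveUnitsMap_twist hγ, map_add, additiveUnitsMap_twist hγ, ← LinearMap.comp_apply, hν,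
      LinearMap.sub_apply, add_add_sub_cancel]
  exact AlgHom.congr_fun hcomp f

include hγ hu in
theorem twist_normalizer_sub_mem {I : Ideal A} (hI : ∀ i, (u (r i) : A) - 1 ∈ I) (f : A) :
    twist γ (normalizer b u r) f - f ∈ I := by
  have hν : additiveUnitsMap (Ideal.Quotient.mk I) ∘ₗ normalizer b u r = 0 := by
    refine b.ext fun i => ?_
    rw [LinearMap.comp_apply, normalizer_basis, map_neg, LinearMap.zero_apply, neg_eq_zero]
    exact Units.ext (Ideal.Quotient.eq.2 (hI i))
  have hcomp : (Ideal.Quotient.mkₐ k I).comp (twist γ (normalizer b u r)) =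
      Ideal.Quotient.mkₐ k I := by
    refine algHom_ext_of_units hu fun p => ?_
    change additiveUnitsMap (Ideal.Quotient.mk I)
      (additiveUnitsMap (twist γ (normalizer b u r) : A →+* A) (Additive.ofMul (u p))) = _
    rw [additiveUnitsMap_twist hγ, map_add, ← LinearMap.comp_apply, hν, LinearMap.zero_apply,
      add_zero]
    rfl
  exact Ideal.Quotient.eq.1 (AlgHom.congr_fun hcomp f)

include hγ hu hr in
theorem bijective_torusInvariants_to_quotient [CharZero k] :
    Function.Bijective ((Ideal.Quotient.mkₐ k
      (Ideal.span (Set.range fun i => (u (r i) : A) - 1))).comp (torusInvariants γ).val) := by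
  set I := Ideal.span (Set.range fun i => (u (r i) : A) - 1)
  have : Module.Free ℤ L := Module.Free.of_basis b
  constructor
  · rw [injective_iff_map_eq_zero]
    intro f hfI
    have hker : I ≤ RingHom.ker (twist γ (normalizer b u r)) := by
      rw [Ideal.span_le]
      rintro _ ⟨i, rfl⟩
      rw [SetLike.mem_coe, RingHom.mem_ker, map_sub, map_one, twist_normalizer_unit hγ b hr,
        sub_self]
    have hf0 : twist γ (normalizer b u r) f = 0 := hker (Ideal.Quotient.eq_zero_iff_mem.1 hfI)
    exact Subtype.ext ((twist_eq_self_of_mem_torusInvariants f.2 _).symm.trans hf0)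
  · intro y
    obtain ⟨f, rfl⟩ := Ideal.Quotient.mk_surjective y
    exact ⟨⟨_, twist_normalizer_mem_torusInvariants hγ hu b hr f⟩, Ideal.Quotient.eq.2
      (twist_normalizer_sub_mem hγ hu b (fun i => Ideal.subset_span (Set.mem_range_self i)) f)⟩

end Slice

namespace SimplexPoint

variable {n : ℕ}

theorem coord_le (t : SimplexPoint n) (i : Fin 4) : t.1 i ≤ n :=
  (Finset.single_le_sum (fun _ _ => Nat.zero_le _) (Finset.mem_univ i)).trans_eq t.2.1

instance : Finite (SimplexPoint n) :=
  Finite.of_injective (fun t i => (⟨t.1 i, Nat.lt_succ_of_le (t.coord_le i)⟩ : Fin (n + 1)))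
    fun _ _ h => Subtype.ext <| funext fun i => Fin.ext_iff.1 (congrFun h i)

theorem coord_eq_zero {t : SimplexPoint n} {s : Finset (Fin 4)} (hs : ∑ i ∈ s, t.1 i = n)
    {i : Fin 4} (hi : i ∉ s) : t.1 i = 0 := by
  have hle := Finset.sum_le_sum_of_subset (f := t.1) (Finset.subset_univ (insert i s))
  rw [Finset.sum_insert hi, hs, t.2.1] at hle
  omega

theorem eq_of_coord_eq {a b c : Fin 4} (hab : a ≠ b) (hbc : b ≠ c) (hac : a ≠ c)
    {s t : SimplexPoint n} (hs : s.1 a + s.1 b + s.1 c = n) (ht : t.1 a + t.1 b + t.1 c = n)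
    (ha : s.1 a = t.1 a) (hb : s.1 b = t.1 b) : s = t := by
  have hface (r : SimplexPoint n) (hr : r.1 a + r.1 b + r.1 c = n) {i : Fin 4}
      (hi : i ∉ ({a, b, c} : Finset (Fin 4))) : r.1 i = 0 :=
    coord_eq_zero (by simp [hab, hac, hbc, ← add_assoc, hr]) hi
  refine Subtype.ext (funext fun i => ?_)
  by_cases hi : i ∈ ({a, b, c} : Finset (Fin 4))
  · simp only [Finset.mem_insert, Finset.mem_singleton] at hi
    obtain rfl | rfl | rfl := hi <;> omega
  · rw [hface s hs hi, hface t ht hi]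

theorem exists_coord_eq {a b c : Fin 4} (hab : a ≠ b) (hbc : b ≠ c) (hac : a ≠ c) {x y z : ℕ}
    (hx : x < n) (hy : y < n) (hz : z < n) (hxyz : x + y + z = n) :
    ∃ t : SimplexPoint n, t.1 a = x ∧ t.1 b = y ∧ t.1 c = z := by
  refine ⟨⟨Pi.single a x + Pi.single b y + Pi.single c z, ?_, fun i => ?_⟩, ?_⟩
  · simpa [Finset.sum_add_distrib] using hxyz
  · simp only [Pi.add_apply, Pi.single_apply]
    grind
  · simp [hab, hbc, hac, hab.symm, hbc.symm, hac.symm]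

end SimplexPoint

namespace IdealTriangulation

section Weights

variable {K : Type*} (T : IdealTriangulation K) (n : ℕ)

instance [Finite K] : Finite (T.IntegralPoint n) := Quot.finite _

/-- The element `x ⊗ e_m` of `C₀ⁿ`, which is zero for `m = 0` and for `m = n`. -/
noncomputable def gen (x : T.Cusp) (m : ℕ) : T.C0 n := Finsupp.single x 1 ⊗ₜ[ℤ] unitVec n m

theorem gen_zero (x : T.Cusp) : T.gen n x 0 = 0 := by simp [gen, unitVec_zero]

theorem gen_self (x : T.Cusp) : T.gen n x n = 0 := by
  have : unitVec n n = 0 := funext fun j => if_neg (by omega)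
  rw [gen, this, TensorProduct.tmul_zero]

theorem basisC0_apply (r : T.Cusp × Fin (n - 1)) : T.basisC0 n r = T.gen n r.1 (r.2 + 1) := by
  have : unitVec n (r.2 + 1) = Pi.single r.2 1 :=
    funext fun j => by simp [unitVec, Pi.single_apply, Fin.ext_iff]
  rw [gen, this]
  exact (Module.Basis.tensorProduct_apply' _ _ r).trans (by simp)

/-- The homomorphism `C₀ⁿ → ℤ/n` with `x ⊗ e_m ↦ m`. Its kernel is the image of `α*`. -/
noncomputable def degreeMod : T.C0 n →ₗ[ℤ] ZMod n :=
  (T.basisC0 n).constr ℤ fun r => ((r.2 + 1 : ℕ) : ZMod n)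

theorem degreeMod_gen (x : T.Cusp) {m : ℕ} (hm : m ≤ n) : T.degreeMod n (T.gen n x m) = m := by
  obtain rfl | hmn := hm.eq_or_lt
  · simp [gen_self]
  obtain _ | m := m
  · simp [gen_zero]
  · have hbasis := T.basisC0_apply n (x, ⟨m, by omega⟩)
    rw [← hbasis, degreeMod, Module.Basis.constr_basis]

theorem card_quotient_ker_degreeMod (hn : 1 ≤ n) (x : T.Cusp) :
    Nat.card (T.C0 n ⧸ LinearMap.ker (T.degreeMod n)) = n := by
  have surjective : Function.Surjective (T.degreeMod n) := fun z => by
    obtain ⟨d, rfl⟩ := ZMod.intCast_surjective z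
    exact ⟨d • T.gen n x 1, by simp [degreeMod_gen _ _ _ hn]⟩
  rw [Nat.card_congr ((T.degreeMod n).quotKerEquivOfSurjective surjective).toEquiv, Nat.card_zmod]

variable {n}

theorem weight_eq_sum_gen {p : T.LabelledPoint n} {s : Finset (Fin 4)}
    (hs : ∑ i ∈ s, p.2.1 i = n) :
    T.weight (T.toIntegralPoint p) = ∑ i ∈ s, T.gen n (T.cusp p.1 i) (p.2.1 i) := by
  change ∑ i, T.gen n (T.cusp p.1 i) (p.2.1 i) = _
  refine (Finset.sum_subset (Finset.subset_univ s) fun i _ hi => ?_).symm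
  rw [SimplexPoint.coord_eq_zero hs hi, gen_zero]

theorem weight_face {k : K} {t : SimplexPoint n} {a b c : Fin 4} (hab : a ≠ b) (hbc : b ≠ c)
    (hac : a ≠ c) (h : t.1 a + t.1 b + t.1 c = n) :
    T.weight (T.toIntegralPoint (k, t)) = T.gen n (T.cusp k a) (t.1 a) +
      T.gen n (T.cusp k b) (t.1 b) + T.gen n (T.cusp k c) (t.1 c) := by
  rw [T.weight_eq_sum_gen (s := {a, b, c}) (by simp [hab, hac, hbc, ← add_assoc, h])]
  simp [hab, hac, hbc, add_assoc]

theorem degreeMod_weight (P : T.IntegralPoint n) : T.degreeMod n (T.weight P) = 0 := by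
  obtain ⟨p, rfl⟩ := Quot.exists_rep P
  change T.degreeMod n (T.weight (T.toIntegralPoint p)) = 0
  rw [T.weight_eq_sum_gen (s := Finset.univ) p.2.2.1, map_sum,
    Finset.sum_congr rfl fun i _ => T.degreeMod_gen n _ (p.2.coord_le i), ← Nat.cast_sum,
    p.2.2.1, ZMod.natCast_self]

/-- The class of `x ⊗ e_m` modulo the weights of the integral points in `S`. -/
noncomputable def genMod (S : Set (T.IntegralPoint n)) (x : T.Cusp) (m : ℕ) :
    T.C0 n ⧸ Submodule.span ℤ (T.weight '' S) :=
  Submodule.Quotient.mk (T.gen n x m)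

theorem genMod_zero (S : Set (T.IntegralPoint n)) (x : T.Cusp) : T.genMod S x 0 = 0 := by
  simp [genMod, gen_zero]

theorem genMod_self (S : Set (T.IntegralPoint n)) (x : T.Cusp) : T.genMod S x n = 0 := by
  simp [genMod, gen_self]

variable {S : Set (T.IntegralPoint n)} {v : T.C0 n ⧸ Submodule.span ℤ (T.weight '' S)}

theorem span_weight_image_eq_ker_degreeMod (h : ∀ y, ∀ m ≤ n, T.genMod S y m = m • v)
    (x : T.Cusp) :
    Submodule.span ℤ (T.weight '' S) = LinearMap.ker (T.degreeMod n) := by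
  refine le_antisymm (Submodule.span_le.2 ?_) fun u hu => ?_
  · rintro _ ⟨P, -, rfl⟩
    exact T.degreeMod_weight P
  have torsion : zmultiplesHom _ v (n : ℤ) = 0 := by
    rw [zmultiplesHom_apply, natCast_zsmul, ← h x n le_rfl, genMod_self]
  let multiples := (ZMod.lift n ⟨zmultiplesHom _ v, torsion⟩).toIntLinearMap
  have factors : (Submodule.span ℤ (T.weight '' S)).mkQ = multiples ∘ₗ T.degreeMod n := by
    refine (T.basisC0 n).ext fun r => ?_
    have hr : (r.2 + 1 : ℕ) ≤ n := by omega
    rw [basisC0_apply, LinearMap.comp_apply, degreeMod_gen _ _ _ hr]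
    rw [← Int.cast_natCast (R := ZMod n)]
    refine (h r.1 _ hr).trans ((natCast_zsmul v _).symm.trans ?_)
    exact (ZMod.lift_coe n ⟨zmultiplesHom _ v, torsion⟩ _).symm
  rw [← Submodule.Quotient.mk_eq_zero, ← Submodule.mkQ_apply, factors, LinearMap.comp_apply,
    LinearMap.mem_ker.1 hu, map_zero]

theorem columnsHaveDet_and_isBasicGenerators [Finite K] (hn : 1 ≤ n)
    (hcard : Nat.card S ≤ Nat.card (T.Cusp × Fin (n - 1)))
    (h : ∀ y, ∀ m ≤ n, T.genMod S y m = m • v) (x : T.Cusp) :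
    T.ColumnsHaveDet S n ∧ IsBasicGenerators (T.alphaStar n) S := by
  have hspan := T.span_weight_image_eq_ker_degreeMod h x
  have hindex := T.card_quotient_ker_degreeMod n hn x
  have hrange : Submodule.span ℤ (Set.range fun P : S => T.weight P.1) =
      Submodule.span ℤ (T.weight '' S) := by rw [Set.image_eq_range]
  have : Module.Finite ℤ (T.C0 n) := Module.Finite.of_basis (T.basisC0 n)
  have : Module.IsTorsionFree ℤ (T.C0 n) := (T.basisC0 n).isTorsionFree
  have : Finite (T.C0 n ⧸ Submodule.span ℤ (Set.range fun P : S => T.weight P.1)) := by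
    rw [hrange, hspan]
    exact Nat.finite_of_card_ne_zero (by omega)
  rw [← Module.finrank_eq_nat_card_basis (T.basisC0 n)] at hcard
  obtain ⟨hcard, hli⟩ := card_eq_finrank_and_linearIndependent_of_finite_quotient_span
    (w := fun P : S => T.weight P.1) hcard
  refine ⟨?_, isBasicGenerators_linearCombination_iff.2 ⟨hli, ?_⟩⟩
  · rw [Module.finrank_eq_nat_card_basis (T.basisC0 n)] at hcard
    obtain ⟨e⟩ := Finite.card_eq.1 hcard.symm
    refine ⟨e, ?_⟩
    classical
    have hdet := abs_det_toMatrix_eq_card_quotient_span (T.basisC0 n) (hli.comp e e.injective)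
    rw [EquivLike.range_comp (fun P : S => T.weight P.1) e, hrange, hspan, hindex] at hdet
    convert hdet using 3
    simp only [alphaStar, Finsupp.linearCombination_single, one_smul]
    rfl
  · refine (Submodule.span_mono (Set.image_subset_range _ _)).antisymm (Submodule.span_le.2 ?_)
    rintro _ ⟨P, rfl⟩
    exact hspan ▸ T.degreeMod_weight P

end Weights

end IdealTriangulation

section SpanningTrees

variable {V E : Type*} {ends : E → Sym2 V}

theorem isAcyclic_fromEdgeSet_singleton (x y : V) :
    (SimpleGraph.fromEdgeSet {s(x, y)}).IsAcyclic := by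
  have := (SimpleGraph.isAcyclic_sup_fromEdgeSet_iff (G := (⊥ : SimpleGraph V)) (u := x)
    (v := y)).2 ⟨SimpleGraph.isAcyclic_bot, fun h => Or.inl (SimpleGraph.reachable_bot.1 h)⟩
  rwa [bot_sup_eq] at this

theorem isAcyclic_fromEdgeSet_pair {x y z : V} (hxz : x ≠ z) (hyz : y ≠ z) :
    (SimpleGraph.fromEdgeSet {s(x, y), s(y, z)}).IsAcyclic := by
  rw [Set.insert_eq, SimpleGraph.fromEdgeSet_union]
  refine (isAcyclic_fromEdgeSet_singleton x y).sup_edge_of_not_reachable fun h => ?_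
  rw [SimpleGraph.reachable_iff_reflTransGen] at h
  obtain h | ⟨w, -, hw⟩ := Relation.ReflTransGen.cases_tail h
  · exact hyz h.symm
  · simp only [SimpleGraph.fromEdgeSet_adj, Set.mem_singleton_iff, Sym2.eq_iff] at hw
    grind

variable [Finite V]

theorem exists_preconnected_of_isTree {G₀ G : Set E} (hsub : G₀ ⊆ G) (hinj : Set.InjOn ends G₀)
    {F : SimpleGraph V} (hF : F.IsTree) (hG₀ : ends '' G₀ ⊆ F.edgeSet)
    (hG : F ≤ SimpleGraph.fromEdgeSet (ends '' G)) :
    ∃ G', G₀ ⊆ G' ∧ G' ⊆ G ∧ (SimpleGraph.fromEdgeSet (ends '' G')).Preconnected ∧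
      G'.ncard + 1 = Nat.card V := by
  have hsurj : Set.SurjOn ends G F.edgeSet := fun e he => by
    have he' := SimpleGraph.edgeSet_mono hG he
    rw [SimpleGraph.edgeSet_fromEdgeSet] at he'
    exact he'.1
  obtain ⟨G', h₀, h, hbij⟩ := hinj.bijOn_image.exists_extend_of_subset hsub hG₀ hsurj
  refine ⟨G', h₀, h, ?_, ?_⟩
  · rw [hbij.image_eq, SimpleGraph.fromEdgeSet_edgeSet]
    exact hF.1.preconnected
  · rw [hbij.ncard_eq]
    exact (SimpleGraph.isTree_iff_connected_and_card.1 hF).2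

variable [Nonempty V]

theorem ncard_add_one_le_of_minimal_preconnected [Finite E] {G : Set E}
    (hG : Minimal (fun G => (SimpleGraph.fromEdgeSet (ends '' G)).Preconnected) G) :
    G.ncard + 1 ≤ Nat.card V := by
  obtain ⟨F, hle, hF⟩ := (SimpleGraph.Connected.mk hG.1).exists_isTree_le
  obtain ⟨G', -, hsub, hG', hcard⟩ := exists_preconnected_of_isTree (Set.empty_subset G)
    (Set.injOn_empty ends) hF (by simp) hle
  rw [← hcard]
  exact Nat.succ_le_succ (Set.ncard_le_ncard (hG.2 hG' hsub))

theorem exists_minimal_preconnected_superset [Finite E]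
    (hpre : (SimpleGraph.fromEdgeSet (ends '' Set.univ)).Preconnected) {G₀ : Set E}
    (hinj : Set.InjOn ends G₀) (hdiag : ∀ e ∈ G₀, ¬ (ends e).IsDiag)
    (hacyclic : (SimpleGraph.fromEdgeSet (ends '' G₀)).IsAcyclic) :
    ∃ G, G₀ ⊆ G ∧ Minimal (fun G => (SimpleGraph.fromEdgeSet (ends '' G)).Preconnected) G := by
  obtain ⟨F, hle₀, hle, hF⟩ :=
    (SimpleGraph.Connected.mk hpre).exists_isTree_le_of_le_of_isAcyclic
      (SimpleGraph.fromEdgeSet_mono (Set.image_mono (Set.subset_univ G₀))) hacyclic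
  have hG₀ : ends '' G₀ ⊆ F.edgeSet := by
    refine subset_trans ?_ (SimpleGraph.edgeSet_mono hle₀)
    rw [SimpleGraph.edgeSet_fromEdgeSet]
    rintro _ ⟨e, he, rfl⟩
    exact ⟨⟨e, he, rfl⟩, hdiag e he⟩
  obtain ⟨G, hsub, -, hG, hcard⟩ :=
    exists_preconnected_of_isTree (Set.subset_univ G₀) hinj hF hG₀ hle
  refine ⟨G, hsub, hG, fun G' hG' hle' => ?_⟩
  have hcard' := (SimpleGraph.Connected.mk hG').card_vert_le_card_edgeSet_add_one
  have hedges : (SimpleGraph.fromEdgeSet (ends '' G')).edgeSet.ncard ≤ G'.ncard := by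
    rw [SimpleGraph.edgeSet_fromEdgeSet]
    exact (Set.ncard_le_ncard Set.sdiff_subset).trans (Set.ncard_image_le (Set.toFinite G'))
  rw [← hcard, Nat.card_coe_set_eq] at hcard'
  exact (Set.eq_of_subset_of_ncard_le hle' (by omega)).ge

end SpanningTrees

namespace IdealTriangulation

section Existence

variable {K : Type*} {T : IdealTriangulation K}

instance [Finite K] : Finite T.OneCell := Quot.finite _

theorem IsConnected.induction_nbr (hT : T.IsConnected) {P : K → Prop} {k : K} (hk : P k)
    (hnbr : ∀ k i, P k → P (T.nbr k i)) (l : K) : P l := by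
  induction hT.2 k l with
  | refl => exact hk
  | tail _ hbc ih =>
    obtain ⟨i, rfl⟩ := hbc
    exact hnbr _ i ih

theorem spans_iff_preconnected (G : Set T.OneCell) :
    T.Spans G ↔ (SimpleGraph.fromEdgeSet (T.ends '' G)).Preconnected := by
  unfold Spans SimpleGraph.Preconnected
  rw [SimpleGraph.reachable_fromEdgeSet_eq_reflTransGen_toRel]
  rfl

theorem isMaximalTree_iff_minimal_preconnected {G : Set T.OneCell} : T.IsMaximalTree G ↔
    Minimal (fun G => (SimpleGraph.fromEdgeSet (T.ends '' G)).Preconnected) G := by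
  rw [IsMaximalTree, funext fun G => propext (T.spans_iff_preconnected G)]

theorem ends_oneCell (k : K) {i j : Fin 4} (h : i ≠ j) :
    T.ends (T.oneCell k i j h) = s(T.cusp k i, T.cusp k j) := rfl

theorem IsConnected.spans_univ (hT : T.IsConnected) : T.Spans Set.univ := by
  intro x y
  obtain ⟨⟨k, i⟩, rfl⟩ := Quot.exists_rep x
  obtain ⟨⟨l, j⟩, rfl⟩ := Quot.exists_rep y
  change Relation.ReflTransGen _ (T.cusp k i) (T.cusp l j)
  have within (l : K) (j j' : Fin 4) : Relation.ReflTransGen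
      (fun a b => ∃ e ∈ Set.univ, T.ends e = s(a, b)) (T.cusp l j) (T.cusp l j') := by
    obtain rfl | h := eq_or_ne j j'
    · rfl
    · exact .single ⟨T.oneCell l j j' h, trivial, rfl⟩
  refine hT.induction_nbr (P := fun l => ∀ j, Relation.ReflTransGen _ (T.cusp k i) (T.cusp l j))
    (within k i) (fun l f ih j => ?_) l j
  obtain ⟨m, hm⟩ := exists_ne f
  refine (ih m).trans ?_
  rw [← T.cusp_glue l hm.symm]
  exact within _ _ _

theorem IsConnected.exists_maximalTree_superset [Finite K] (hT : T.IsConnected)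
    {G₀ : Set T.OneCell} (hinj : Set.InjOn T.ends G₀) (hdiag : ∀ e ∈ G₀, ¬ (T.ends e).IsDiag)
    (hacyclic : (SimpleGraph.fromEdgeSet (T.ends '' G₀)).IsAcyclic) :
    ∃ G, G₀ ⊆ G ∧ T.IsMaximalTree G := by
  have : Nonempty T.Cusp := hT.1.map fun k => T.cusp k 0
  simp only [isMaximalTree_iff_minimal_preconnected]
  exact exists_minimal_preconnected_superset ((T.spans_iff_preconnected _).1 hT.spans_univ)
    hinj hdiag hacyclic

theorem IsConnected.exists_face_of_hasSelfEdge (hT : T.IsConnected) (hv : 1 < Nat.card T.Cusp)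
    (h : T.HasSelfEdge) : ∃ k a b c, a ≠ b ∧ b ≠ c ∧ a ≠ c ∧ T.cusp k a = T.cusp k b ∧
      T.cusp k b ≠ T.cusp k c := by
  obtain ⟨e, he⟩ := h
  obtain ⟨⟨k, ⟨⟨i, j⟩, hij⟩⟩, rfl⟩ := Quot.exists_rep e
  by_contra! hface
  have collapse {k : K} {a b : Fin 4} (hab : a ≠ b) (h : T.cusp k a = T.cusp k b) (c : Fin 4) :
      T.cusp k c = T.cusp k a := by
    grind
  have allEqual := hT.induction_nbr (P := fun l => ∀ m, T.cusp l m = T.cusp k i)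
    (collapse hij he) fun l f ih m => by
      obtain ⟨p, q, hp, hq, hpq⟩ : ∃ p q : Fin 4, f ≠ p ∧ f ≠ q ∧ p ≠ q := by
        revert f
        decide
      have hcusp (r : Fin 4) (hr : f ≠ r) : T.cusp (T.nbr l f) (T.perm l f r) = T.cusp k i := by
        rw [T.cusp_glue l hr, ih]
      rw [← hcusp p hp]
      exact collapse ((T.perm l f).injective.ne hpq) ((hcusp p hp).trans (hcusp q hq).symm) m
  have : Subsingleton T.Cusp := ⟨fun x y => by
    obtain ⟨⟨l, m⟩, rfl⟩ := Quot.exists_rep x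
    obtain ⟨⟨l', m'⟩, rfl⟩ := Quot.exists_rep y
    exact (allEqual l m).trans (allEqual l' m').symm⟩
  exact hv.not_ge (Finite.card_le_one_iff_subsingleton.2 this)

theorem IsConnected.exists_isOneCuspFamily (n : ℕ) (hT : T.IsConnected) :
    ∃ S, T.IsOneCuspFamily n S := by
  obtain ⟨k⟩ := hT.1
  exact ⟨_, k, 0, 1, 2, by decide, by decide, by decide, rfl⟩

theorem IsConnected.exists_isOneCycleFamily [Finite K] (n : ℕ) (hT : T.IsConnected)
    (hv : 1 < Nat.card T.Cusp) (h : T.HasSelfEdge) : ∃ S, T.IsOneCycleFamily n S := by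
  obtain ⟨k, a, b, c, hab, hbc, hac, heq, hne⟩ := hT.exists_face_of_hasSelfEdge hv h
  obtain ⟨G, hsub, hG⟩ := hT.exists_maximalTree_superset (G₀ := {T.oneCell k b c hbc})
    (Set.injOn_singleton _ _) (by simpa [ends_oneCell] using hne)
    (by simpa [ends_oneCell] using isAcyclic_fromEdgeSet_singleton _ _)
  exact ⟨_, k, a, b, c, G, hab, hbc, hac, heq, hne, hG, hsub rfl, rfl⟩

theorem IsConnected.exists_isThreeCycleFamily [Finite K] (n : ℕ) (hT : T.IsConnected)
    (h : ¬ T.HasSelfEdge) : ∃ S, T.IsThreeCycleFamily n S := by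
  obtain ⟨k⟩ := hT.1
  have hne {i j : Fin 4} (hij : i ≠ j) : T.cusp k i ≠ T.cusp k j :=
    fun he => h ⟨T.oneCell k i j hij, he⟩
  have h01 := hne (i := 0) (j := 1) (by decide)
  have h12 := hne (i := 1) (j := 2) (by decide)
  have h02 := hne (i := 0) (j := 2) (by decide)
  obtain ⟨G, hsub, hG⟩ := hT.exists_maximalTree_superset
    (G₀ := {T.oneCell k 0 1 (by decide), T.oneCell k 1 2 (by decide)})
    (Set.injOn_pair.2 fun he => by
      rw [ends_oneCell, ends_oneCell, Sym2.eq_iff] at he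
      grind)
    (by simp [ends_oneCell, h01, h12])
    (by simpa [Set.image_pair, ends_oneCell] using isAcyclic_fromEdgeSet_pair h02 h12)
  exact ⟨_, k, 0, 1, 2, G, by decide, by decide, by decide, h01, h12, h02, hG,
    hsub (.inl rfl), hsub (.inr rfl), rfl⟩

end Existence

section Families

variable {K : Type*} {T : IdealTriangulation K} {n : ℕ} {S : Set (T.IntegralPoint n)}

theorem genMod_face {k : K} {a b c : Fin 4} (hab : a ≠ b) (hbc : b ≠ c) (hac : a ≠ c)
    {Q : ℕ → ℕ → ℕ → Prop} (hS : T.facePoints n k a b c Q ⊆ S) {x y z : ℕ} (h : x + y + z = n)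
    (hQ : Q x y z) :
    T.genMod S (T.cusp k a) x + T.genMod S (T.cusp k b) y + T.genMod S (T.cusp k c) z = 0 := by
  by_cases hlt : x < n ∧ y < n ∧ z < n
  · obtain ⟨t, rfl, rfl, rfl⟩ := SimplexPoint.exists_coord_eq hab hbc hac hlt.1 hlt.2.1 hlt.2.2 h
    simp only [genMod, ← Submodule.Quotient.mk_add, ← T.weight_face hab hbc hac h]
    rw [Submodule.Quotient.mk_eq_zero]
    exact Submodule.subset_span ⟨_, hS ⟨t, rfl, h, hQ⟩, rfl⟩
  · obtain ⟨rfl, rfl, rfl⟩ | ⟨rfl, rfl, rfl⟩ | ⟨rfl, rfl, rfl⟩ :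
        (x = n ∧ y = 0 ∧ z = 0) ∨ (x = 0 ∧ y = n ∧ z = 0) ∨ (x = 0 ∧ y = 0 ∧ z = n) := by omega
    all_goals simp only [genMod_zero, genMod_self, add_zero]

theorem exists_third_vertex (i j : Fin 4) : ∃ l, j ≠ l ∧ i ≠ l := by
  revert i j
  decide

theorem genMod_edge {G : Set T.OneCell} (hS : T.edgePoints n G ⊆ S) {e : T.OneCell} (he : e ∈ G)
    {x y : T.Cusp} (hxy : T.ends e = s(x, y)) {m m' : ℕ} (hm : m + m' = n) :
    T.genMod S x m + T.genMod S y m' = 0 := by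
  obtain ⟨⟨k, ⟨⟨i, j⟩, hij⟩⟩, rfl⟩ := Quot.exists_rep e
  obtain ⟨l, hjl, hil⟩ := exists_third_vertex i j
  have hface : T.facePoints n k i j l (fun _ _ z => z = 0) ⊆ S := by
    rintro _ ⟨t, rfl, ht, hl⟩
    exact hS ⟨(k, t), i, j, hij, rfl, by simpa [hl] using ht, he⟩
  have hrel {m m' : ℕ} (hm : m + m' = n) :
      T.genMod S (T.cusp k i) m + T.genMod S (T.cusp k j) m' = 0 := by
    simpa [genMod_zero] using genMod_face hij hjl hil hface (z := 0) hm rfl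
  obtain ⟨rfl, rfl⟩ | ⟨rfl, rfl⟩ := Sym2.eq_iff.1 ((T.ends_oneCell k hij).symm.trans hxy)
  · exact hrel hm
  · rw [add_comm]
    exact hrel ((add_comm _ _).trans hm)

theorem genMod_eq_smul_of_spans {G : Set T.OneCell} (hS : T.edgePoints n G ⊆ S) (hG : T.Spans G)
    {v : T.C0 n ⧸ Submodule.span ℤ (T.weight '' S)} {x : T.Cusp}
    (h : ∀ m ≤ n, T.genMod S x m = m • v) (y : T.Cusp) : ∀ m ≤ n, T.genMod S y m = m • v := by
  have torsion : n • v = 0 := by rw [← h n le_rfl, genMod_self]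
  induction hG x y with
  | refl => exact h
  | tail _ hedge ih =>
    obtain ⟨e, he, hends⟩ := hedge
    intro m hm
    have hsum : (n - m) • v + m • v = 0 := by rw [← add_smul, Nat.sub_add_cancel hm, torsion]
    have hrel := genMod_edge hS he hends (Nat.sub_add_cancel hm)
    rw [ih _ (Nat.sub_le n m), ← hsum] at hrel
    exact add_left_cancel hrel

theorem ncard_facePoints_le [Finite K] (k : K) {a b c : Fin 4} (hab : a ≠ b) (hbc : b ≠ c)
    (hac : a ≠ c) {Q : ℕ → ℕ → ℕ → Prop} {N : ℕ} (f : ℕ → ℕ × ℕ)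
    (hf : ∀ x y z, x < n → y < n → z < n → x + y + z = n → Q x y z → ∃ i < N, f i = (x, y)) :
    (T.facePoints n k a b c Q).ncard ≤ N := by
  let U : Set (SimplexPoint n) := {t | t.1 a + t.1 b + t.1 c = n ∧ Q (t.1 a) (t.1 b) (t.1 c)}
  have hU : T.facePoints n k a b c Q = (fun t => T.toIntegralPoint (k, t)) '' U := by
    ext P
    exact exists_congr fun t => and_comm
  have hinj : U.InjOn fun t => (t.1 a, t.1 b) := fun s hs t ht hst =>
    SimplexPoint.eq_of_coord_eq hab hbc hac hs.1 ht.1 (Prod.ext_iff.1 hst).1 (Prod.ext_iff.1 hst).2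
  have hsub : (fun t : SimplexPoint n => (t.1 a, t.1 b)) '' U ⊆ f '' Set.Iio N := by
    rintro _ ⟨t, ht, rfl⟩
    have hlt (i : Fin 4) : t.1 i < n := (t.coord_le i).lt_of_ne (t.2.2 i)
    exact hf _ _ _ (hlt a) (hlt b) (hlt c) ht.1 ht.2
  calc (T.facePoints n k a b c Q).ncard ≤ U.ncard := hU ▸ Set.ncard_image_le (Set.toFinite U)
    _ = _ := hinj.ncard_image.symm
    _ ≤ (f '' Set.Iio N).ncard := Set.ncard_le_ncard hsub (Set.toFinite _)
    _ ≤ (Set.Iio N).ncard := Set.ncard_image_le (Set.toFinite _)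
    _ = N := Set.ncard_Iio_nat N

variable (T n) in
/-- The integral points on the edge of simplex `k` joining vertices `i` and `j`. -/
def simplexEdgePoints (k : K) (i j : Fin 4) : Set (T.IntegralPoint n) :=
  {P | ∃ t : SimplexPoint n, T.toIntegralPoint (k, t) = P ∧ t.1 i + t.1 j = n}

theorem simplexEdgePoints_comm (k : K) (i j : Fin 4) :
    T.simplexEdgePoints n k i j = T.simplexEdgePoints n k j i := by
  simp only [simplexEdgePoints, add_comm]

theorem simplexEdgePoints_subset_glue (k : K) {i j l : Fin 4} (hij : i ≠ j) (hli : l ≠ i)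
    (hlj : l ≠ j) : T.simplexEdgePoints n k i j ⊆
      T.simplexEdgePoints n (T.nbr k l) (T.perm k l i) (T.perm k l j) := by
  rintro _ ⟨t, rfl, ht⟩
  have hzero : t.1 l = 0 :=
    SimplexPoint.coord_eq_zero (s := {i, j}) (by rwa [Finset.sum_pair hij]) (by simp [hli, hlj])
  exact ⟨t.permute (T.perm k l), (Quot.sound ⟨l, hzero, rfl⟩).symm,
    by simpa [SimplexPoint.permute] using ht⟩

theorem simplexEdgePoints_glue (k : K) {i j l : Fin 4} (hij : i ≠ j) (hli : l ≠ i) (hlj : l ≠ j) :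
    T.simplexEdgePoints n (T.nbr k l) (T.perm k l i) (T.perm k l j) =
      T.simplexEdgePoints n k i j := by
  have hinj := (T.perm k l).injective
  refine (simplexEdgePoints_subset_glue k hij hli hlj).antisymm' ?_
  have := simplexEdgePoints_subset_glue (T := T) (n := n) (T.nbr k l) (hinj.ne hij)
    (hinj.ne hli) (hinj.ne hlj)
  simpa only [T.nbr_nbr, T.perm_perm, Equiv.Perm.inv_def, Equiv.symm_apply_apply] using this

variable (T n) in
/-- The integral points on a 1-cell. -/
def oneCellPoints : T.OneCell → Set (T.IntegralPoint n) :=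
  Quot.lift (fun a => T.simplexEdgePoints n a.1 a.2.1.1 a.2.1.2) <| by
    rintro ⟨k, ⟨⟨i, j⟩, hij⟩⟩ ⟨k', ⟨⟨i', j'⟩, h'⟩⟩ (⟨rfl, h⟩ | ⟨l, hli, hlj, rfl, h⟩)
    · obtain ⟨rfl, rfl⟩ := Prod.mk.inj h
      exact simplexEdgePoints_comm _ _ _
    · obtain ⟨rfl, rfl⟩ := Prod.mk.inj h
      exact (simplexEdgePoints_glue k hij hli hlj).symm

theorem ncard_oneCellPoints_le [Finite K] (e : T.OneCell) :
    (T.oneCellPoints n e).ncard ≤ n - 1 := by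
  obtain ⟨⟨k, ⟨⟨i, j⟩, hij⟩⟩, rfl⟩ := Quot.exists_rep e
  obtain ⟨l, hjl, hil⟩ := exists_third_vertex i j
  have hsub : T.simplexEdgePoints n k i j ⊆ T.facePoints n k i j l fun _ _ z => z = 0 := by
    rintro _ ⟨t, rfl, ht⟩
    have hzero : t.1 l = 0 := SimplexPoint.coord_eq_zero (s := {i, j})
      (by rwa [Finset.sum_pair hij]) (by simp [hil.symm, hjl.symm])
    exact ⟨t, rfl, by rw [hzero, add_zero, ht], hzero⟩
  refine (Set.ncard_le_ncard hsub).trans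
    (ncard_facePoints_le k hij hjl hil (fun r => (r + 1, n - 1 - r)) ?_)
  intro x y z hx hy _ hxyz hz
  exact ⟨x - 1, by omega, by ext <;> dsimp only <;> omega⟩

theorem ncard_edgePoints_le [Finite K] (G : Set T.OneCell) :
    (T.edgePoints n G).ncard ≤ G.ncard * (n - 1) := by
  classical
  have hsub : T.edgePoints n G ⊆ ⋃ e ∈ (Set.toFinite G).toFinset, T.oneCellPoints n e := by
    rintro _ ⟨⟨k, t⟩, i, j, hij, rfl, ht, he⟩
    simp only [Set.Finite.mem_toFinset, Set.mem_iUnion]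
    exact ⟨_, he, t, rfl, ht⟩
  calc (T.edgePoints n G).ncard ≤ _ := Set.ncard_le_ncard hsub
    _ ≤ _ := Finset.set_ncard_biUnion_le _ _
    _ ≤ _ := Finset.sum_le_card_nsmul _ _ (n - 1) fun e _ => ncard_oneCellPoints_le e
    _ = _ := by rw [Set.ncard_eq_toFinset_card G, smul_eq_mul]

theorem card_union_edgePoints_le [Finite K] [Nonempty T.Cusp] {G : Set T.OneCell}
    (hG : T.IsMaximalTree G) {F : Set (T.IntegralPoint n)} (hF : F.ncard ≤ n - 1) :
    Nat.card (F ∪ T.edgePoints n G : Set (T.IntegralPoint n)) ≤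
      Nat.card (T.Cusp × Fin (n - 1)) := by
  have hG' := ncard_add_one_le_of_minimal_preconnected (isMaximalTree_iff_minimal_preconnected.1 hG)
  rw [Nat.card_coe_set_eq, Nat.card_prod, Nat.card_fin]
  calc (F ∪ T.edgePoints n G).ncard ≤ F.ncard + (T.edgePoints n G).ncard := Set.ncard_union_le _ _
    _ ≤ (n - 1) + G.ncard * (n - 1) := Nat.add_le_add hF (ncard_edgePoints_le G)
    _ = (G.ncard + 1) * (n - 1) := by ring
    _ ≤ Nat.card T.Cusp * (n - 1) := Nat.mul_le_mul_right _ hG'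

theorem eq_nsmul_of_recurrence {M : Type*} [AddCommGroup M] {h g : ℕ → M} (h0 : h 0 = 0)
    (hedge : ∀ m m', m + m' = n → h m + g m' = 0)
    (hface : ∀ j j', 0 < j → 1 + j + j' = n → h 1 + h j + g j' = 0) :
    ∀ m ≤ n, h m = m • h 1
  | 0, _ => by rw [h0, zero_smul]
  | 1, _ => (one_smul ℕ _).symm
  | j + 2, hj => by
    have hsum := (hedge (j + 2) (n - (j + 2)) (by omega)).trans
      (hface (j + 1) (n - (j + 2)) j.succ_pos (by omega)).symm
    rw [add_right_cancel hsum, eq_nsmul_of_recurrence h0 hedge hface (j + 1) (by omega),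
      ← succ_nsmul']

theorem IsOneCuspFamily.columnsHaveDet_and_isBasicGenerators [Finite K] (hn : 1 ≤ n)
    (hv : Nat.card T.Cusp = 1) (h : T.IsOneCuspFamily n S) :
    T.ColumnsHaveDet S n ∧ IsBasicGenerators (T.alphaStar n) S := by
  obtain ⟨k, a, b, c, hab, hbc, hac, hS⟩ := h
  have : Subsingleton T.Cusp := (Nat.card_eq_one_iff_unique.1 hv).1
  set x₀ := T.cusp k a
  have hrel {x y z : ℕ} (hxyz : x + y + z = n) (hx : x ≤ 1) (hy : 0 < y) (hz : 0 < z) :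
      T.genMod S x₀ x + T.genMod S x₀ y + T.genMod S x₀ z = 0 := by
    have hface {y z : ℕ} (h : x + y + z = n) (hy : 0 < y) (hyz : y ≤ z) := by
      simpa only [Subsingleton.elim _ x₀] using genMod_face hab hbc hac hS.ge h ⟨hx, hy, hyz⟩
    obtain hyz | hyz := le_total y z
    · exact hface hxyz hy hyz
    · rw [add_right_comm]
      exact hface (by omega) hz hyz
  have hedge (m m' : ℕ) (h : m + m' = n) : T.genMod S x₀ m + T.genMod S x₀ m' = 0 := by
    obtain rfl | hm := m.eq_zero_or_pos
    · obtain rfl : m' = n := by omega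
      rw [genMod_zero, genMod_self, zero_add]
    obtain rfl | hm' := m'.eq_zero_or_pos
    · obtain rfl : m = n := h
      rw [genMod_zero, genMod_self, zero_add]
    simpa only [genMod_zero, zero_add] using hrel (x := 0) (by omega) zero_le_one hm hm'
  have hmultiples := eq_nsmul_of_recurrence (T.genMod_zero S x₀) hedge fun j j' hj h => by
    obtain rfl | hj' := j'.eq_zero_or_pos
    · rw [genMod_zero, add_zero]
      exact hedge 1 j h
    · exact hrel h le_rfl hj hj'
  refine T.columnsHaveDet_and_isBasicGenerators hn ?_
    (fun y m hm => (congrArg (T.genMod S · m) (Subsingleton.elim y x₀)).trans (hmultiples m hm)) x₀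
  rw [Nat.card_prod, Nat.card_fin, hv, one_mul, Nat.card_coe_set_eq, hS]
  refine ncard_facePoints_le k hab hbc hac (fun i => (i % 2, i / 2 + 1)) fun x y z _ _ _ _ _ => ?_
  exact ⟨2 * (y - 1) + x, by omega, by ext <;> dsimp only <;> omega⟩

theorem IsOneCycleFamily.columnsHaveDet_and_isBasicGenerators [Finite K] (hn : 1 ≤ n)
    (h : T.IsOneCycleFamily n S) :
    T.ColumnsHaveDet S n ∧ IsBasicGenerators (T.alphaStar n) S := by
  obtain ⟨k, a, b, c, G, hab, hbc, hac, hcusp, -, hG, hGbc, hS⟩ := h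
  obtain ⟨hface, hedge⟩ := Set.union_subset_iff.1 hS.ge
  have : Nonempty T.Cusp := ⟨T.cusp k a⟩
  have hmultiples := eq_nsmul_of_recurrence (T.genMod_zero S (T.cusp k a))
    (fun m m' hm => genMod_edge hedge hGbc (by rw [ends_oneCell, hcusp]) hm)
    (fun j j' hj hjj' => by
      simpa only [← hcusp] using genMod_face hab hbc hac hface hjj' ⟨rfl, hj⟩)
  refine T.columnsHaveDet_and_isBasicGenerators hn ?_
    (genMod_eq_smul_of_spans hedge hG.1 hmultiples) (T.cusp k a)
  rw [hS]
  refine card_union_edgePoints_le hG ?_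
  refine ncard_facePoints_le k hab hbc hac (fun i => (1, i + 1)) fun x y z _ _ _ _ _ => ?_
  exact ⟨y - 1, by omega, by ext <;> dsimp only <;> omega⟩

theorem IsThreeCycleFamily.columnsHaveDet_and_isBasicGenerators [Finite K] (hn : 1 ≤ n)
    (h : T.IsThreeCycleFamily n S) :
    T.ColumnsHaveDet S n ∧ IsBasicGenerators (T.alphaStar n) S := by
  obtain ⟨k, a, b, c, G, hab, hbc, hac, -, -, -, hG, hGab, hGbc, hS⟩ := h
  obtain ⟨hface, hedge⟩ := Set.union_subset_iff.1 hS.ge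
  have : Nonempty T.Cusp := ⟨T.cusp k a⟩
  have hab_rel {m m' : ℕ} := genMod_edge (m := m) (m' := m') hedge hGab (T.ends_oneCell k hab)
  have hbc_rel := genMod_edge hedge hGbc (T.ends_oneCell k hbc) (Nat.sub_add_cancel hn)
  have hca : T.genMod S (T.cusp k c) 1 = T.genMod S (T.cusp k a) 1 :=
    add_left_cancel (hbc_rel.trans ((add_comm _ _).trans (hab_rel (by omega))).symm)
  have hmultiples := eq_nsmul_of_recurrence (T.genMod_zero S (T.cusp k a))
    (fun m m' => hab_rel)
    (fun j j' hj hjj' => by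
      have hrel := genMod_face hab hbc hac hface (y := j') (z := 1) (by omega) ⟨hj, rfl⟩
      rwa [hca, add_rotate, add_assoc, add_comm] at hrel)
  refine T.columnsHaveDet_and_isBasicGenerators hn ?_
    (genMod_eq_smul_of_spans hedge hG.1 hmultiples) (T.cusp k a)
  rw [hS]
  refine card_union_edgePoints_le hG ?_
  refine ncard_facePoints_le k hab hbc hac (fun i => (i + 1, n - 2 - i)) fun x y z _ _ _ _ _ => ?_
  exact ⟨x - 1, by omega, by ext <;> dsimp only <;> omega⟩

end Families

section WeightLattice

variable {K : Type*} (T : IdealTriangulation K) {n : ℕ}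

/-- The image of `α*`: the character lattice of the quotient of the torus that acts effectively. -/
noncomputable abbrev weightLattice (n : ℕ) : Submodule ℤ (T.C0 n) :=
  Submodule.span ℤ (Set.range T.weight)

/-- The weight of the Ptolemy coordinate at `p` as an element of the weight lattice. -/
noncomputable def latticeWeight (p : T.LabelledPoint n) : T.weightLattice n :=
  ⟨T.weight (T.toIntegralPoint p), Submodule.subset_span (Set.mem_range_self _)⟩

theorem latticeWeight_glue {p : T.LabelledPoint n} {i : Fin 4} (h : p.2.1 i = 0) :
    T.latticeWeight (T.glue p i) = T.latticeWeight p :=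
  Subtype.ext (T.labelledWeight_glue p i h)

theorem coe_latticeWeight_add_addEdge (k : K) (a : Fin 4 → ℕ) (ha : ∑ i, a i + 2 = n)
    {i j l m : Fin 4} (hij : i ≠ j) (hlm : l ≠ m) (h : i ≠ l ∧ i ≠ m ∧ j ≠ l ∧ j ≠ m) :
    ((T.latticeWeight (k, .addEdge a ha i j hij) + T.latticeWeight (k, .addEdge a ha l m hlm) :
      T.weightLattice n) : T.C0 n) =
      ∑ r, (T.gen n (T.cusp k r) (a r) + T.gen n (T.cusp k r) (a r + 1)) := by
  simp only [Submodule.coe_add, latticeWeight]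
  rw [T.weight_eq_sum_gen (SimplexPoint.addEdge a ha i j hij).2.1,
    T.weight_eq_sum_gen (SimplexPoint.addEdge a ha l m hlm).2.1, ← Finset.sum_add_distrib]
  unfold SimplexPoint.addEdge
  refine Finset.sum_congr rfl fun r _ => ?_
  have hr : r = i ∨ r = j ∨ r = l ∨ r = m := by
    revert i j l m r
    decide
  obtain ⟨hil, him, hjl, hjm⟩ := h
  rcases hr with rfl | rfl | rfl | rfl
  · simp [hij, hil, him, add_comm]
  · simp [hij.symm, hjl, hjm, add_comm]
  · simp [hil.symm, hjl.symm, hlm]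
  · simp [him.symm, hjm.symm, hlm.symm]

theorem gen_eq_sum_basisC0 (y : T.Cusp) (m : ℕ) :
    T.gen n y m = ∑ j, unitVec n m j • T.basisC0 n (y, j) := by
  have hbasis (j : Fin (n - 1)) :
      T.basisC0 n (y, j) = Finsupp.single y 1 ⊗ₜ[ℤ] Pi.basisFun ℤ (Fin (n - 1)) j :=
    (Module.Basis.tensorProduct_apply' _ _ _).trans (by simp)
  simp only [hbasis, ← TensorProduct.tmul_smul, ← TensorProduct.tmul_sum]
  exact congrArg _ ((Pi.basisFun ℤ (Fin (n - 1))).sum_repr (unitVec n m)).symm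

/-- The evaluation of the characters in the weight lattice at a torus element. -/
noncomputable def torusHom (x : T.Torus n) : T.weightLattice n →ₗ[ℤ] Additive ℂˣ :=
  (T.basisC0 n).constr ℤ (fun r => Additive.ofMul (x r.1 r.2)) ∘ₗ (T.weightLattice n).subtype

theorem torusHom_latticeWeight (x : T.Torus n) (p : T.LabelledPoint n) :
    T.torusHom x (T.latticeWeight p) = Additive.ofMul (T.character x p) := by
  change (T.basisC0 n).constr ℤ (fun r => Additive.ofMul (x r.1 r.2))
    (T.weight (T.toIntegralPoint p)) = _
  rw [T.weight_eq_sum_gen p.2.2.1, map_sum, character, ofMul_prod]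
  refine Finset.sum_congr rfl fun i _ => ?_
  rw [gen_eq_sum_basisC0, map_sum, ofMul_prod]
  refine Finset.sum_congr rfl fun j _ => ?_
  rw [map_zsmul, Module.Basis.constr_basis, ofMul_zpow]

theorem torusHom_surjective : Function.Surjective (T.torusHom (n := n)) := by
  intro φ
  obtain ⟨f, rfl⟩ := (baer_additive_units ℂ).extension_property (T.weightLattice n).subtype
    Subtype.val_injective φ
  exact ⟨fun y j => (f (T.basisC0 n (y, j))).toMul,
    congrArg (· ∘ₗ _) ((T.basisC0 n).ext fun r => Module.Basis.constr_basis ..)⟩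

end WeightLattice

section PtolemyAssignments

variable {K : Type*} {T : IdealTriangulation K} {n : ℕ} {R : Type*} [CommRing R] [Algebra ℂ R]

/-- The Ptolemy relations and the identification relations for coordinates in the units of a
`ℂ`-algebra. -/
structure IsPtolemyAssignment (c : T.LabelledPoint n → Rˣ) : Prop where
  ptolemy : ∀ k a (ha : ∑ i, a i + 2 = n), T.ptolemyExpr (fun p => (c p : R)) k a ha = 0
  glue : ∀ p i, p.2.1 i = 0 →
    (c p : R) = algebraMap ℂ R (blockSign (T.perm p.1 i) p.2.1) * c (T.glue p i)

namespace IsPtolemyAssignment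

variable {c : T.LabelledPoint n → Rˣ}

theorem map (hc : T.IsPtolemyAssignment c) {B : Type*} [CommRing B] [Algebra ℂ B]
    (f : R →ₐ[ℂ] B) : T.IsPtolemyAssignment fun p => Units.map (f : R →* B) (c p) where
  ptolemy k a ha := by simpa [ptolemyExpr] using congrArg f (hc.ptolemy k a ha)
  glue p i hp := by simpa using congrArg f (hc.glue p i hp)

theorem mul_weights (hc : T.IsPtolemyAssignment c) (ψ : T.weightLattice n →ₗ[ℤ] Additive Rˣ) :
    T.IsPtolemyAssignment fun p => c p * (ψ (T.latticeWeight p)).toMul where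
  ptolemy k a ha := by
    let edge (i j : Fin 4) (hij : i ≠ j) : T.LabelledPoint n := (k, .addEdge a ha i j hij)
    let unit (i j : Fin 4) (hij : i ≠ j) : R := (ψ (T.latticeWeight (edge i j hij))).toMul.val
    have homogeneous {i j l m i' j' l' m' : Fin 4} (hij : i ≠ j) (hlm : l ≠ m) (hij' : i' ≠ j')
        (hlm' : l' ≠ m') (h : i ≠ l ∧ i ≠ m ∧ j ≠ l ∧ j ≠ m)
        (h' : i' ≠ l' ∧ i' ≠ m' ∧ j' ≠ l' ∧ j' ≠ m') :
        unit i j hij * unit l m hlm = unit i' j' hij' * unit l' m' hlm' := by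
      have hweights := Subtype.ext ((T.coe_latticeWeight_add_addEdge k a ha hij hlm h).trans
        (T.coe_latticeWeight_add_addEdge k a ha hij' hlm' h').symm)
      simpa only [map_add, toMul_add, Units.val_mul] using
        congrArg (fun v => ((ψ v).toMul : R)) hweights
    have h01 := homogeneous (i := 0) (j := 1) (l := 2) (m := 3) (i' := 0) (j' := 3) (l' := 1)
      (m' := 2) (by decide) (by decide) (by decide) (by decide) (by decide) (by decide)
    have h02 := homogeneous (i := 0) (j := 2) (l := 1) (m := 3) (i' := 0) (j' := 3) (l' := 1)
      (m' := 2) (by decide) (by decide) (by decide) (by decide) (by decide) (by decide)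
    have hrel := hc.ptolemy k a ha
    simp only [ptolemyExpr, Units.val_mul] at hrel ⊢
    linear_combination
      unit 0 3 (by decide) * unit 1 2 (by decide) * hrel +
      (c (edge 0 1 (by decide)) * c (edge 2 3 (by decide))) * h01 -
      (c (edge 0 2 (by decide)) * c (edge 1 3 (by decide))) * h02
  glue p i hp := by
    rw [T.latticeWeight_glue hp, Units.val_mul, Units.val_mul, hc.glue p i hp, mul_assoc]

theorem aeval_eq_zero (hc : T.IsPtolemyAssignment c) {f : T.PolyRing n}
    (hf : f ∈ T.relationIdeal n) : MvPolynomial.aeval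
      (Sum.elim (fun p => (c p : R)) fun p => ((c p)⁻¹ : Rˣ).1) f = 0 := by
  suffices hle : T.relationIdeal n ≤ RingHom.ker (MvPolynomial.aeval (R := ℂ)
      (Sum.elim (fun p => (c p : R)) fun p => ((c p)⁻¹ : Rˣ).1)) from hle hf
  refine Ideal.span_le.2 ?_
  rintro f (⟨k, a, ha, rfl⟩ | ⟨p, i, hp, rfl⟩ | ⟨p, rfl⟩) <;> rw [SetLike.mem_coe, RingHom.mem_ker]
  · simpa [ptolemyExpr] using hc.ptolemy k a ha
  · simpa [sub_eq_zero] using hc.glue p i hp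
  · simp

end IsPtolemyAssignment

end PtolemyAssignments

section CoordinateRing

variable {K : Type*} (T : IdealTriangulation K) {n : ℕ}

/-- The Ptolemy coordinate at `p` as a unit of the coordinate ring. -/
noncomputable def coordUnit (p : T.LabelledPoint n) : (T.CoordRing n)ˣ :=
  have h : Ideal.Quotient.mk (T.relationIdeal n) (.X (.inl p) * .X (.inr p)) = 1 :=
    Ideal.Quotient.eq.2 (Ideal.subset_span (Or.inr (Or.inr ⟨p, rfl⟩)))
  ⟨Ideal.Quotient.mk _ (.X (.inl p)), Ideal.Quotient.mk _ (.X (.inr p)), by rw [← map_mul, h],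
    by rw [mul_comm, ← map_mul, h]⟩

theorem isPtolemyAssignment_coordUnit : T.IsPtolemyAssignment (T.coordUnit (n := n)) where
  ptolemy k a ha :=
    Ideal.Quotient.eq_zero_iff_mem.2 (Ideal.subset_span (Or.inl ⟨k, a, ha, rfl⟩))
  glue p i hp := Ideal.Quotient.eq.2 (Ideal.subset_span (Or.inr (Or.inl ⟨p, i, hp, rfl⟩)))

theorem adjoin_coordUnit : Algebra.adjoin ℂ
    ((Set.range fun p => (T.coordUnit (n := n) p).1) ∪
      Set.range fun p => ((T.coordUnit p)⁻¹).1) = ⊤ := by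
  have hrange := Algebra.map_top (Ideal.Quotient.mkₐ ℂ (T.relationIdeal n))
  rw [(AlgHom.range_eq_top _).2 (Ideal.Quotient.mkₐ_surjective ℂ (T.relationIdeal n)),
    ← MvPolynomial.adjoin_range_X, AlgHom.map_adjoin, ← Set.range_comp] at hrange
  rw [← hrange, ← Set.Sum.elim_range]
  congr 2
  funext v
  obtain p | p := v <;> rfl

theorem coordRing_algHom_ext {R : Type*} [CommRing R] [Algebra ℂ R] {F G : T.CoordRing n →ₐ[ℂ] R}
    (h : ∀ p, F (T.coordUnit p).1 = G (T.coordUnit p).1) : F = G :=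
  algHom_ext_of_units T.adjoin_coordUnit fun p => Units.ext (h p)

variable {T}

/-- The homomorphism from the coordinate ring given by a Ptolemy assignment. -/
noncomputable def coordLift {R : Type*} [CommRing R] [Algebra ℂ R] {c : T.LabelledPoint n → Rˣ}
    (hc : T.IsPtolemyAssignment c) : T.CoordRing n →ₐ[ℂ] R :=
  Ideal.Quotient.liftₐ _ (MvPolynomial.aeval
    (Sum.elim (fun p => (c p : R)) fun p => ((c p)⁻¹ : Rˣ).1)) fun _ => hc.aeval_eq_zero

theorem coordLift_coordUnit {R : Type*} [CommRing R] [Algebra ℂ R] {c : T.LabelledPoint n → Rˣ}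
    (hc : T.IsPtolemyAssignment c) (p : T.LabelledPoint n) :
    coordLift hc (T.coordUnit p).1 = c p :=
  MvPolynomial.aeval_X _ (Sum.inl p)

end CoordinateRing

section Coaction

open AddMonoidAlgebra

variable {K : Type*} (T : IdealTriangulation K) {n : ℕ}

/-- The diagonal action in the form of a coaction: the grading of the coordinate ring by the weight
lattice, in which the Ptolemy coordinate at `p` is homogeneous of degree `latticeWeight p`. -/
noncomputable def coaction : T.CoordRing n →ₐ[ℂ] (T.CoordRing n)[T.weightLattice n] :=
  coordLift ((T.isPtolemyAssignment_coordUnit.map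
    (IsScalarTower.toAlgHom ℂ (T.CoordRing n) (T.CoordRing n)[T.weightLattice n])).mul_weights
    (monomialUnit (T.CoordRing n) (T.weightLattice n)))

theorem coaction_coordUnit (p : T.LabelledPoint n) :
    T.coaction (T.coordUnit p).1 = single (T.latticeWeight p) (T.coordUnit p).1 := by
  rw [coaction, coordLift_coordUnit]
  change single 0 (T.coordUnit p).1 * single (T.latticeWeight p) 1 = _
  rw [single_mul_single, zero_add, mul_one]

theorem coordAct_coordUnit (x : T.Torus n) (p : T.LabelledPoint n) :
    T.coordAct x (T.coordUnit p).1 =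
      algebraMap ℂ _ (T.character x p).1 * (T.coordUnit p).1 := by
  change Ideal.Quotient.mkₐ ℂ (T.relationIdeal n) (T.polyAct x (.X (.inl p))) = _
  rw [polyAct, MvPolynomial.aeval_X, Sum.elim_inl, map_mul, MvPolynomial.algHom_C]
  rfl

theorem twist_coaction_torusHom (x : T.Torus n) :
    twist T.coaction (additiveUnitsMap (algebraMap ℂ (T.CoordRing n)) ∘ₗ T.torusHom x) =
      T.coordAct x := by
  refine T.coordRing_algHom_ext fun p => ?_
  have htwist := additiveUnitsMap_twist T.coaction_coordUnit
    (additiveUnitsMap (algebraMap ℂ (T.CoordRing n)) ∘ₗ T.torusHom x) p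
  rw [LinearMap.comp_apply, torusHom_latticeWeight] at htwist
  rw [coordAct_coordUnit, mul_comm]
  exact congrArg (fun v => (v.toMul : T.CoordRing n)) htwist

theorem torusInvariants_coaction : torusInvariants (T.coaction (n := n)) = T.invariantRing n :=
  (T.torusHom_surjective.iInf_congr _ fun x => by rw [twist_coaction_torusHom]).symm

variable {T} {S : Set (T.IntegralPoint n)} {rep : T.IntegralPoint n → T.LabelledPoint n}

theorem latticeWeight_rep (h : IsBasicGenerators (T.alphaStar n) S)
    (hrep : ∀ P, T.toIntegralPoint (rep P) = P) (P : S) :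
    T.latticeWeight (rep P) = h.basis P :=
  Subtype.ext ((congrArg T.weight (hrep P)).trans (h.coe_basis P).symm)

theorem bijective_invariantRing_to_quotient (h : IsBasicGenerators (T.alphaStar n) S)
    (hrep : ∀ P, T.toIntegralPoint (rep P) = P) :
    Function.Bijective
      ((Ideal.Quotient.mkₐ ℂ (T.sliceIdeal rep S)).comp (T.invariantRing n).val) := by
  have hideal : T.sliceIdeal rep S =
      Ideal.span (Set.range fun P : S => (T.coordUnit (rep P)).1 - 1) :=
    congrArg Ideal.span (Set.image_eq_range _ S)
  rw [hideal, ← torusInvariants_coaction]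
  exact bijective_torusInvariants_to_quotient T.coaction_coordUnit T.adjoin_coordUnit h.basis
    (latticeWeight_rep h hrep)

end Coaction

section Points

variable {K : Type*} {T : IdealTriangulation K} {n : ℕ}

/-- The coordinates of a point of the Ptolemy variety, as units of `ℂ`. -/
noncomputable def pointUnit (c : T.ptolemyVariety n) (p : T.LabelledPoint n) : ℂˣ :=
  Units.mk0 (c.1 p) (c.2.1 p)

theorem isPtolemyAssignment_pointUnit (c : T.ptolemyVariety n) :
    T.IsPtolemyAssignment (pointUnit c) where
  ptolemy := c.2.2.1
  glue := c.2.2.2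

theorem pointUnit_smul (x : T.Torus n) (c : T.ptolemyVariety n) (p : T.LabelledPoint n) :
    pointUnit (x • c) p = T.character x p * pointUnit c p :=
  Units.ext rfl

/-- Evaluation of elements of the coordinate ring at a point of the Ptolemy variety. -/
noncomputable def evalAt (c : T.ptolemyVariety n) : T.CoordRing n →ₐ[ℂ] ℂ :=
  coordLift (isPtolemyAssignment_pointUnit c)

theorem evalAt_coordUnit (c : T.ptolemyVariety n) (p : T.LabelledPoint n) :
    evalAt c (T.coordUnit p).1 = c.1 p :=
  coordLift_coordUnit _ p

theorem evalAt_smul (x : T.Torus n) (c : T.ptolemyVariety n) :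
    evalAt (x • c) = (evalAt c).comp (T.coordAct x) := by
  refine T.coordRing_algHom_ext fun p => ?_
  rw [AlgHom.comp_apply, coordAct_coordUnit, map_mul, AlgHom.commutes, evalAt_coordUnit,
    evalAt_coordUnit]
  rfl

theorem mem_regularFunctions {V : Set (T.LabelledPoint n → ℂ)} (hV : V ⊆ T.ptolemyVariety n)
    {f : V → ℂ} :
    f ∈ T.regularFunctions V ↔ ∃ F, ∀ c : V, evalAt ⟨c.1, hV c.2⟩ F = f c := by
  let restrict : T.CoordRing n →ₐ[ℂ] V → ℂ := AlgHom.pi fun c : V => evalAt ⟨c.1, hV c.2⟩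
  have hcoord (p : T.LabelledPoint n) : restrict (T.coordUnit p).1 = fun c : V => c.1 p :=
    funext fun c => evalAt_coordUnit _ p
  have hinv (p : T.LabelledPoint n) :
      restrict ((T.coordUnit p)⁻¹).1 = fun c : V => (c.1 p)⁻¹ := funext fun c => by
    refine eq_inv_of_mul_eq_one_right ?_
    have := congrFun (congrArg restrict (T.coordUnit p).mul_inv) c
    rw [map_mul, map_one, hcoord] at this
    exact this
  have hrange : T.regularFunctions V = restrict.range := by
    rw [← Algebra.map_top, ← T.adjoin_coordUnit, AlgHom.map_adjoin, Set.image_union,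
      ← Set.range_comp, ← Set.range_comp, regularFunctions]
    simp only [Function.comp_def, hcoord, hinv]
  rw [hrange, AlgHom.mem_range]
  exact exists_congr fun F => funext_iff

variable {S : Set (T.IntegralPoint n)} {rep : T.IntegralPoint n → T.LabelledPoint n}

theorem exists_smul_mem_slice (h : IsBasicGenerators (T.alphaStar n) S)
    (hrep : ∀ P, T.toIntegralPoint (rep P) = P) (c : T.ptolemyVariety n) :
    ∃ x : T.Torus n, (x • c).1 ∈ T.slice rep S := by
  obtain ⟨x, hx⟩ := T.torusHom_surjective
    (normalizer h.basis (pointUnit c) fun P : S => rep P)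
  refine ⟨x, (x • c).2, fun P hP => ?_⟩
  have hchar := T.torusHom_latticeWeight x (rep P)
  rw [hx, latticeWeight_rep h hrep ⟨P, hP⟩, normalizer_basis] at hchar
  have hone : pointUnit (x • c) (rep P) = 1 := by
    rw [pointUnit_smul, ← inv_mul_cancel (pointUnit c (rep P))]
    exact congrArg (· * _) hchar.symm
  exact congrArg Units.val hone

theorem smul_eq_of_mem_slice (h : IsBasicGenerators (T.alphaStar n) S)
    (hrep : ∀ P, T.toIntegralPoint (rep P) = P) {c : T.ptolemyVariety n} {x : T.Torus n}
    (hc : c.1 ∈ T.slice rep S) (hxc : (x • c).1 ∈ T.slice rep S) : x • c = c := by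
  have hx : T.torusHom x = 0 := by
    refine h.basis.ext fun P => ?_
    have hsmul : (T.character x (rep P) : ℂ) * c.1 (rep P) = 1 := hxc.2 P P.2
    rw [hc.2 P P.2, mul_one, Units.val_eq_one] at hsmul
    rw [← latticeWeight_rep h hrep, torusHom_latticeWeight, hsmul, ofMul_one, LinearMap.zero_apply]
  refine Subtype.ext (funext fun p => ?_)
  have hchar : T.character x p = 1 := by
    rw [← ofMul_eq_zero, ← torusHom_latticeWeight, hx, LinearMap.zero_apply]
  change (T.character x p : ℂ) * c.1 p = c.1 p
  rw [hchar, Units.val_one, one_mul]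

theorem bijective_slice_to_quotient (h : IsBasicGenerators (T.alphaStar n) S)
    (hrep : ∀ P, T.toIntegralPoint (rep P) = P) :
    Function.Bijective
      (fun c : T.slice rep S => (Quotient.mk _ ⟨c.1, c.2.1⟩ : T.ReducedPtolemyVariety n)) := by
  constructor
  · rintro ⟨c, hc⟩ ⟨c', hc'⟩ hcc'
    obtain ⟨x, hx⟩ : ∃ x : T.Torus n, x • (⟨c', hc'.1⟩ : T.ptolemyVariety n) = ⟨c, hc.1⟩ :=
      Quotient.exact hcc'
    have hfix : x • (⟨c', hc'.1⟩ : T.ptolemyVariety n) = ⟨c', hc'.1⟩ :=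
      smul_eq_of_mem_slice h hrep hc' (by rwa [hx])
    have hval : c = c' := congrArg Subtype.val (hx.symm.trans hfix)
    exact Subtype.ext hval
  · intro y
    obtain ⟨c, rfl⟩ := Quotient.exists_rep y
    obtain ⟨x, hx⟩ := exists_smul_mem_slice h hrep c
    exact ⟨⟨_, hx⟩, Quotient.sound ⟨x, rfl⟩⟩

theorem slice_subset_ptolemyVariety : T.slice rep S ⊆ T.ptolemyVariety n := fun _ hc => hc.1

theorem bijOn_invariantFunctions (h : IsBasicGenerators (T.alphaStar n) S)
    (hrep : ∀ P, T.toIntegralPoint (rep P) = P) :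
    Set.BijOn (fun f (c : T.slice rep S) => f ⟨c.1, c.2.1⟩)
      (T.invariantFunctions n) (T.regularFunctions (T.slice rep S)) := by
  refine ⟨?_, ?_, ?_⟩
  · rintro f ⟨hf, -⟩
    obtain ⟨F, hF⟩ := (mem_regularFunctions subset_rfl).1 hf
    exact (mem_regularFunctions slice_subset_ptolemyVariety).2 ⟨F, fun c => hF ⟨c.1, c.2.1⟩⟩
  · rintro f ⟨-, hf⟩ g ⟨-, hg⟩ hfg
    funext c
    obtain ⟨x, hx⟩ := exists_smul_mem_slice h hrep c
    rw [← hf x c, ← hg x c]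
    exact congrFun hfg ⟨_, hx⟩
  · intro g hg
    obtain ⟨G, hG⟩ := (mem_regularFunctions slice_subset_ptolemyVariety).1 hg
    set F := twist T.coaction (normalizer h.basis T.coordUnit fun P : S => rep P) G
    have hF : F ∈ torusInvariants T.coaction := twist_normalizer_mem_torusInvariants
      T.coaction_coordUnit T.adjoin_coordUnit h.basis (latticeWeight_rep h hrep) G
    refine ⟨fun c => evalAt c F, ⟨(mem_regularFunctions subset_rfl).2 ⟨F, fun _ => rfl⟩,
      fun x c => ?_⟩, funext fun c => ?_⟩
    · have hxF := mem_torusInvariants.1 hF (T.torusHom x)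
      rw [twist_coaction_torusHom] at hxF
      exact (AlgHom.congr_fun (evalAt_smul x c) F).trans (congrArg (evalAt c) hxF)
    · set c' : T.ptolemyVariety n := ⟨c.1, c.2.1⟩
      have hFG : F - G ∈ RingHom.ker (evalAt c') :=
        twist_normalizer_sub_mem T.coaction_coordUnit T.adjoin_coordUnit h.basis
          (fun P => by
            rw [RingHom.mem_ker, map_sub, map_one, evalAt_coordUnit, sub_eq_zero]
            exact c.2.2 P P.2) G
      rw [RingHom.mem_ker, map_sub, sub_eq_zero] at hFG
      exact hFG.trans (hG c)

end Points

section Basic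

variable {K : Type*} [Finite K] {T : IdealTriangulation K} {n : ℕ}

theorem IsConnected.isBasic_alphaStar (hT : T.IsConnected) (hn : 1 ≤ n) :
    IsBasic (T.alphaStar n) := by
  by_cases hv : Nat.card T.Cusp = 1
  · exact (hT.exists_isOneCuspFamily n).imp fun S hS =>
      (hS.columnsHaveDet_and_isBasicGenerators hn hv).2
  by_cases h : T.HasSelfEdge
  · obtain ⟨k⟩ := hT.1
    have : Nonempty T.Cusp := ⟨T.cusp k 0⟩
    have hpos : 0 < Nat.card T.Cusp := Nat.card_pos
    exact (hT.exists_isOneCycleFamily n (by omega) h).imp fun S hS =>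
      (hS.columnsHaveDet_and_isBasicGenerators hn).2
  · exact (hT.exists_isThreeCycleFamily n h).imp fun S hS =>
      (hS.columnsHaveDet_and_isBasicGenerators hn).2

end Basic

end IdealTriangulation

theorem mainTheorem6 {K : Type*} [Finite K] (T : IdealTriangulation K) (hT : T.IsConnected)
    (n : ℕ) (hn : 2 ≤ n) :
    -- the map `α*` is basic
    IsBasic (T.alphaStar n) ∧
    -- explicit sets of integral points exist in each of the three cases
    ((Nat.card T.Cusp = 1 → ∃ S, T.IsOneCuspFamily n S) ∧
      (1 < Nat.card T.Cusp → T.HasSelfEdge → ∃ S, T.IsOneCycleFamily n S) ∧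
      (1 < Nat.card T.Cusp → ¬ T.HasSelfEdge → ∃ S, T.IsThreeCycleFamily n S)) ∧
    -- their columns form a matrix of determinant `± n`, and they are basic generators
    (∀ S : Set (T.IntegralPoint n),
      (Nat.card T.Cusp = 1 ∧ T.IsOneCuspFamily n S) ∨ T.IsOneCycleFamily n S ∨
        T.IsThreeCycleFamily n S →
      T.ColumnsHaveDet S n ∧ IsBasicGenerators (T.alphaStar n) S) ∧
    -- for every set of basic generators, the reduced variety is the subvariety where their
    -- coordinates are `1`: on points, on regular functions, and on coordinate rings
    ∀ S : Set (T.IntegralPoint n), IsBasicGenerators (T.alphaStar n) S →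
      ∀ rep : T.IntegralPoint n → T.LabelledPoint n, (∀ P, T.toIntegralPoint (rep P) = P) →
      Function.Bijective
        (fun c : T.slice rep S => (Quotient.mk _ ⟨c.1, c.2.1⟩ : T.ReducedPtolemyVariety n)) ∧
      Set.BijOn (fun f (c : T.slice rep S) => f ⟨c.1, c.2.1⟩)
        (T.invariantFunctions n) (T.regularFunctions (T.slice rep S)) ∧
      Function.Bijective
        ((Ideal.Quotient.mkₐ ℂ (T.sliceIdeal rep S)).comp (T.invariantRing n).val) := by
  have hn1 : 1 ≤ n := one_le_two.trans hn
  refine ⟨hT.isBasic_alphaStar hn1, ⟨fun _ => hT.exists_isOneCuspFamily n,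
    fun hv h => hT.exists_isOneCycleFamily n hv h, fun _ h => hT.exists_isThreeCycleFamily n h⟩,
    ?_, fun S hS rep hrep => ⟨IdealTriangulation.bijective_slice_to_quotient hS hrep,
      IdealTriangulation.bijOn_invariantFunctions hS hrep,
      IdealTriangulation.bijective_invariantRing_to_quotient hS hrep⟩⟩
  rintro S (⟨hv, h⟩ | h | h)
  · exact h.columnsHaveDet_and_isBasicGenerators hn1 hv
  · exact h.columnsHaveDet_and_isBasicGenerators hn1
  · exact h.columnsHaveDet_and_isBasicGenerators hn1
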